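/- Let $n\ge 2$ be an integer. For a real algebraic number $\alpha$, let $p\in\mathbb{Z}[x]$ be its minimal polynomial over $\mathbb{Z}$, i.e. a nonzero integer polynomial of least degree with $p(\alpha)=0$ whose coefficients have greatest common divisor $1$ (it is unique up to sign). The degree $\deg(\alpha)$ is the degree of $p$, and the height $H(\alpha)$ is the maximum of the absolute values of the coefficients of $p$. For $S\subseteq\mathbb{R}$ and real $Q$, let $\Phi_n(Q,S)$ be the number of real algebraic numbers $\alpha\in S$ with $\deg(\alpha)=n$ and $H(\alpha)\le Q$. Put $\ell(2)=1$ and $\ell(n)=0$ for $n\ge 3$. For every $x\in\mathbb{R}$ the limit $$F_n(x)=\lim_{Q\to\infty}\frac{\Phi_n(Q,(-\infty,x])}{\Phi_n(Q,\mathbb{R})}$$ exists, the function $F_n$ is differentiable on $\mathbb{R}$, and the distribution density $\rho_n=F_n'$ is integrable on $\mathbb{R}$. Moreover, there is a constant $C$ depending only on $n$ with the following property. Let $(\alpha_i)_{i=1}^\infty$ be any sequence that contains every real algebraic number of degree $n$ exactly once and satisfies $H(\alpha_i)\le H(\alpha_{i+1})$ for all $i\ge 1$. Then for every interval $I\subseteq\mathbb{R}$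 (bounded or unbounded, with or without its endpoints) and every integer $N\ge 2$, $$\left|\#\{1\le i\le N:\alpha_i\in I\}-N\int_I\rho_n(x)\,dx\right|\le C\,N^{\frac{n}{n+1}}(\ln N)^{\ell(n)}.$$ -/

import Mathlib

open Polynomial Filter Topology

namespace RealAlgDist

/-- The naive height `H(p) = max |a_i|` of an integer polynomial. -/
def polyHeight (p : ℤ[X]) : ℕ := p.support.sup fun i => (p.coeff i).natAbs

/-- `p` is a minimal polynomial over `ℤ` of the real number `x`: a nonzero integer polynomial
vanishing at `x`, of least degree among all such, whose coefficients have gcd `1`.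
Such a `p` is unique up to sign. -/
structure IsIntMinpoly (p : ℤ[X]) (x : ℝ) : Prop where
  ne_zero : p ≠ 0
  root : aeval x p = 0
  minimal : ∀ q : ℤ[X], q ≠ 0 → aeval x q = 0 → p.natDegree ≤ q.natDegree
  primitive : p.IsPrimitive

open Classical in
/-- A minimal polynomial over `ℤ` of an algebraic `x`; the choice of the sign affects neither its
degree nor its height. (The value is `0` when `x` is transcendental.) -/
noncomputable def intMinpoly (x : ℝ) : ℤ[X] :=
  if h : ∃ p, IsIntMinpoly p x then h.choose else 0

/-- The degree of an algebraic number. -/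
noncomputable def degree (x : ℝ) : ℕ := (intMinpoly x).natDegree

/-- The height of an algebraic number. -/
noncomputable def height (x : ℝ) : ℕ := polyHeight (intMinpoly x)

/-- The real algebraic numbers of degree `n`. -/
def algNumbers (n : ℕ) : Set ℝ := {x | IsAlgebraic ℤ x ∧ degree x = n}

/-- The real algebraic numbers of degree `n` and height at most `Q`. -/
def algNumbersLE (n : ℕ) (Q : ℝ) : Set ℝ := {x ∈ algNumbers n | (height x : ℝ) ≤ Q}

/-- The counting function `Φ_n(Q, S)`. -/
noncomputable def countingFunction (n : ℕ) (Q : ℝ) (S : Set ℝ) : ℕ := (algNumbersLE n Q ∩ S).ncard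

/-- The proportion `Φ_n(Q, (-∞, x]) / Φ_n(Q, ℝ)`. -/
noncomputable def proportion (n : ℕ) (x Q : ℝ) : ℝ :=
  (countingFunction n Q (Set.Iic x) : ℝ) / (countingFunction n Q Set.univ : ℝ)

/-- The distribution function `F_n(x) = lim_{Q → ∞} Φ_n(Q, (-∞, x]) / Φ_n(Q, ℝ)`. -/
noncomputable def distributionFunction (n : ℕ) (x : ℝ) : ℝ := limUnder atTop (proportion n x)

/-- The distribution density `ρ_n = F_n'`. -/
noncomputable def distributionDensity (n : ℕ) : ℝ → ℝ := deriv (distributionFunction n)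

/-- The exponent `ℓ(n)` of the logarithm, for `n ≥ 2`. -/
def ell (n : ℕ) : ℕ := if n = 2 then 1 else 0

/-- `α 0, α 1, …` lists every real algebraic number of degree `n` exactly once,
by non-decreasing height. -/
structure IsHeightOrdering (n : ℕ) (α : ℕ → ℝ) : Prop where
  injective : Function.Injective α
  range_eq : Set.range α = algNumbers n
  height_le : ∀ i, height (α i) ≤ height (α (i + 1))

/-- The number of the first `N` terms of the sequence that lie in `S`. -/
noncomputable def countFirst (α : ℕ → ℝ) (N : ℕ) (S : Set ℝ) : ℕ := {i : ℕ | i < N ∧ α i ∈ S}.ncard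

end RealAlgDist

/-! Up to the sign of the minimal polynomial, the real algebraic numbers of degree `n` and height at
most `Q` are the roots of the irreducible primitive integer polynomials of degree `n` with
coefficients in `[-Q, Q]`. The proof counts pairs (polynomial, root in `I`), with error terms
uniform in the interval `I`.

Lattice points against volume. Fix all coefficients except the coefficient `t` of `x ^ k`, and let
`h` be the fixed part. A point `x ≠ 0` is a root iff `t = -h(x) / x ^ k`, and this function is
injective between consecutive critical points. Hence the root count is, as a function of `t`, a sum
of boundedly many indicators of intervals, and for each of them the sum over integers and the
integral differ by at most 1 (`abs_sumSubIntegral_rootCount_le`). Replacing sums by integrals one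
coordinate at a time, then rescaling, gives `Q ^ (n + 1) * V(I) + O(Q ^ n)` roots in total, where
`V` is `rootVolume`.

Density. Integrating first over the constant term, the area formula and Tonelli turn `V(I)` into the
integral over `I` of a continuous function, `rootDensity`. The limit distribution is `V((-∞, x]) /
V(ℝ)`, which is therefore differentiable.

Sieving. Möbius inversion over the content isolates primitive polynomials and introduces the factor
`∑ μ(d) / d ^ (n + 1)`. Polynomials of lower degree number `O(Q ^ n)`. Reducible ones are bounded
through Gelfond's inequality on the heights of factors; the logarithm comes from a harmonic sum that
occurs only for `n = 2`. The result is `exists_abs_countingFunction_sub_le`.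

Sequences. If `Q` is the height of the `N`-th term, the first `N` terms include every number of
height at most `Q - 1` and only numbers of height at most `Q`. Applying the asymptotics to `I` and
to `ℝ` eliminates `Q ^ (n + 1)`, and `Q ^ (n + 1) = O(N)` converts the error into a power of `N`. -/

namespace RealAlgDist

open Classical MeasureTheory
open scoped Pointwise

/-! ### Polynomials as coefficient vectors -/

/-- The polynomial whose coefficients are the entries of a vector. -/
noncomputable def vecPoly {R : Type*} [Semiring R] {m : ℕ} (a : Fin m → R) : R[X] :=
  ∑ i : Fin m, monomial (i : ℕ) (a i)

section vecPoly

variable {R : Type*} [CommRing R] {m : ℕ}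

lemma vecPoly_coeff (a : Fin m → R) (j : ℕ) :
    (vecPoly a).coeff j = if h : j < m then a ⟨j, h⟩ else 0 := by
  rw [vecPoly, finsetSum_coeff]
  simp only [coeff_monomial]
  split_ifs with h
  · rw [Finset.sum_eq_single ⟨j, h⟩]
    · simp
    · intro b _ hb
      rw [if_neg]
      rintro rfl
      exact hb rfl
    · simp
  · apply Finset.sum_eq_zero
    intro i _
    rw [if_neg]
    rintro rfl
    exact h i.2

lemma vecPoly_coeff_fin (a : Fin m → R) (j : Fin m) : (vecPoly a).coeff j = a j := by
  rw [vecPoly_coeff, dif_pos j.2]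

lemma vecPoly_injective : Function.Injective (vecPoly : (Fin m → R) → R[X]) := by
  intro a b h
  funext i
  rw [← vecPoly_coeff_fin a, h, vecPoly_coeff_fin]

lemma vecPoly_zero : vecPoly (0 : Fin m → R) = 0 := by simp [vecPoly]

lemma vecPoly_eq_zero_iff (a : Fin m → R) : vecPoly a = 0 ↔ a = 0 :=
  ⟨fun h => vecPoly_injective (h.trans vecPoly_zero.symm), fun h => h ▸ vecPoly_zero⟩

lemma vecPoly_smul (c : R) (a : Fin m → R) : vecPoly (c • a) = C c * vecPoly a := by
  ext j
  rw [coeff_C_mul, vecPoly_coeff, vecPoly_coeff]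
  split_ifs <;> simp

lemma vecPoly_map {S : Type*} [CommRing S] (f : R →+* S) (a : Fin m → R) :
    (vecPoly a).map f = vecPoly (fun i => f (a i)) := by
  simp [vecPoly, Polynomial.map_sum]

lemma vecPoly_eval (a : Fin m → R) (x : R) :
    (vecPoly a).eval x = ∑ i : Fin m, a i * x ^ (i : ℕ) := by
  simp [vecPoly, eval_finsetSum]

lemma vecPoly_update_eval (a : Fin m → R) (k : Fin m) (t x : R) :
    (vecPoly (Function.update a k t)).eval x =
      (vecPoly (Function.update a k 0)).eval x + t * x ^ (k : ℕ) := by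
  simp only [vecPoly_eval]
  rw [← Finset.add_sum_erase _ _ (Finset.mem_univ k), ← Finset.add_sum_erase (Finset.univ) _ (Finset.mem_univ k)]
  simp only [Function.update_self, zero_mul, zero_add]
  rw [add_comm]
  congr 1
  apply Finset.sum_congr rfl
  intro i hi
  rw [Function.update_of_ne (Finset.ne_of_mem_erase hi), Function.update_of_ne (Finset.ne_of_mem_erase hi)]

lemma vecPoly_natDegree_lt [Nontrivial R] (a : Fin m → R) (ha : a ≠ 0) : (vecPoly a).natDegree < m := by
  by_contra h
  have h0 : vecPoly a ≠ 0 := fun h => ha ((vecPoly_eq_zero_iff a).1 h)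
  have := leadingCoeff_ne_zero.2 h0
  rw [leadingCoeff, vecPoly_coeff, dif_neg h] at this
  exact this rfl

lemma vecPoly_coeff_self {p : R[X]} (hp : p.natDegree < m) :
    vecPoly (fun i : Fin m => p.coeff i) = p := by
  ext j
  rw [vecPoly_coeff]
  split_ifs with h
  · rfl
  · exact (coeff_eq_zero_of_natDegree_lt (by omega)).symm

end vecPoly

/-! ### Root counts and the gaps of a finite set -/

/-- The number of distinct roots of `p` in `I` (zero for `p = 0`). -/
noncomputable def rootCount (I : Set ℝ) (p : ℝ[X]) : ℕ :=
  (p.roots.toFinset.filter (· ∈ I)).card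

lemma rootCount_zero (I : Set ℝ) : rootCount I 0 = 0 := by simp [rootCount]

lemma rootCount_le (I : Set ℝ) (p : ℝ[X]) : rootCount I p ≤ p.natDegree :=
  (Finset.card_filter_le _ _).trans ((Multiset.toFinset_card_le _).trans (card_roots' p))

lemma rootCount_C_mul (I : Set ℝ) {c : ℝ} (hc : c ≠ 0) (p : ℝ[X]) :
    rootCount I (C c * p) = rootCount I p := by
  rw [rootCount, rootCount, roots_C_mul p hc]

lemma rootCount_vecPoly_le (I : Set ℝ) {m : ℕ} (a : Fin m → ℝ) :
    rootCount I (vecPoly a) ≤ m := by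
  by_cases ha : a = 0
  · rw [ha, vecPoly_zero, rootCount_zero]
    exact Nat.zero_le _
  · exact (rootCount_le I _).trans (vecPoly_natDegree_lt a ha).le

/-- The points outside the finite set `Z` that have exactly `j` elements of `Z` to their left. -/
def gap (Z : Finset ℝ) (j : ℕ) : Set ℝ := {x | x ∉ Z ∧ (Z.filter (· < x)).card = j}

/-- The number of elements of `Z` to the left is monotone, and it strictly increases when a point of
`Z` is passed, so no such point can lie between two points of one gap. -/
lemma gap_ordConnected (Z : Finset ℝ) (j : ℕ) : (gap Z j).OrdConnected := by
  refine ⟨fun x hx y hy u hu => ?_⟩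
  have hxu : (Z.filter (· < x)) ⊆ (Z.filter (· < u)) :=
    Finset.monotone_filter_right _ fun z _ hz => lt_of_lt_of_le hz hu.1
  have huy : (Z.filter (· < u)) ⊆ (Z.filter (· < y)) :=
    Finset.monotone_filter_right _ fun z _ hz => lt_of_lt_of_le hz hu.2
  have h1 := Finset.card_le_card hxu
  have h2 := Finset.card_le_card huy
  refine ⟨fun huZ => ?_, ?_⟩
  · have hne : u ≠ y := fun h => hy.1 (h ▸ huZ)
    have : (Z.filter (· < u)) ⊂ (Z.filter (· < y)) := by
      refine Finset.ssubset_iff_subset_ne.2 ⟨huy, fun h => ?_⟩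
      have : u ∈ Z.filter (· < y) := Finset.mem_filter.2 ⟨huZ, lt_of_le_of_ne hu.2 hne⟩
      rw [← h] at this
      exact lt_irrefl _ (Finset.mem_filter.1 this).2
    have := Finset.card_lt_card this
    have := hx.2
    have := hy.2
    omega
  · have := hx.2
    have := hy.2
    omega

/-- The gaps `0, …, Z.card` partition the complement of `Z`. When each holds at most one root, the
count becomes a sum of 0/1 existence indicators, with the points of `Z` tested one by one. -/
lemma rootCount_eq_sum_gap (I : Set ℝ) (Z : Finset ℝ) {q : ℝ[X]} (hq : q ≠ 0)
    (hinj : ∀ j, ∀ x ∈ I ∩ gap Z j, ∀ y ∈ I ∩ gap Z j, q.eval x = 0 → q.eval y = 0 → x = y) :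
    rootCount I q = (∑ j ∈ Finset.range (Z.card + 1),
        if ∃ x ∈ I ∩ gap Z j, q.eval x = 0 then 1 else 0) +
      ∑ z ∈ Z, if z ∈ I ∧ q.eval z = 0 then 1 else 0 := by
  set R := q.roots.toFinset.filter (· ∈ I) with hR
  have memR : ∀ x, x ∈ R ↔ x ∈ I ∧ q.eval x = 0 := by
    intro x
    simp [hR, hq, and_comm]
  have h1 : rootCount I q = (R.filter (· ∉ Z)).card + (R.filter (· ∈ Z)).card := by
    rw [add_comm, Finset.card_filter_add_card_filter_not]
    rfl
  rw [h1]
  congr 1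
  · rw [Finset.card_eq_sum_card_fiberwise (f := fun x => (Z.filter (· < x)).card)
      (t := Finset.range (Z.card + 1))]
    · apply Finset.sum_congr rfl
      intro j _
      split_ifs with h
      · obtain ⟨x, hx, hx0⟩ := h
        rw [Finset.card_eq_one]
        refine ⟨x, ?_⟩
        ext y
        simp only [Finset.mem_filter, Finset.mem_singleton, memR]
        constructor
        · rintro ⟨⟨⟨hyI, hy0⟩, hyZ⟩, hyj⟩
          exact hinj j y ⟨hyI, hyZ, hyj⟩ x hx hy0 hx0
        · rintro rfl
          exact ⟨⟨⟨hx.1, hx0⟩, hx.2.1⟩, hx.2.2⟩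
      · rw [Finset.card_eq_zero, Finset.eq_empty_iff_forall_notMem]
        intro y hy
        simp only [Finset.mem_filter, memR] at hy
        exact h ⟨y, ⟨hy.1.1.1, hy.1.2, hy.2⟩, hy.1.1.2⟩
    · intro x _
      simp only [Finset.coe_range, Set.mem_Iio]
      exact Nat.lt_succ_of_le (Finset.card_filter_le _ _)
  · rw [← Finset.sum_filter, ← Finset.card_eq_sum_ones]
    congr 1
    ext y
    simp only [Finset.mem_filter, memR]
    tauto

/-! ### Sum against integral on a line -/

/-- The number of integers in a bounded interval differs from its length by at most one. -/
lemma abs_card_int_sub_volume_le {T : Set ℝ} (hT : T.OrdConnected) (Q : ℝ) :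
    |(((Finset.Icc (-⌊Q⌋) ⌊Q⌋).filter (fun t : ℤ => (t : ℝ) ∈ T)).card : ℝ) -
      (volume (T ∩ Set.Icc (-Q) Q)).toReal| ≤ 1 := by
  have hmem : ∀ t : ℤ, t ∈ (Finset.Icc (-⌊Q⌋) ⌊Q⌋).filter (fun t : ℤ => (t : ℝ) ∈ T) ↔
      (t : ℝ) ∈ T ∩ Set.Icc (-Q) Q := by
    intro t
    rw [Finset.mem_filter, Finset.mem_Icc, Set.mem_inter_iff, Set.mem_Icc, Int.le_floor]
    have : -⌊Q⌋ ≤ t ↔ -Q ≤ (t : ℝ) := by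
      rw [neg_le, Int.le_floor]
      push_cast
      exact neg_le
    tauto
  set F := (Finset.Icc (-⌊Q⌋) ⌊Q⌋).filter (fun t : ℤ => (t : ℝ) ∈ T)
  set U := T ∩ Set.Icc (-Q) Q with hU
  have hUc : U.OrdConnected := hT.inter Set.ordConnected_Icc
  have hba : BddAbove U := ⟨Q, fun x hx => hx.2.2⟩
  have hbb : BddBelow U := ⟨-Q, fun x hx => hx.2.1⟩
  rcases U.eq_empty_or_nonempty with h | h
  · have : F = ∅ := Finset.eq_empty_iff_forall_notMem.2 fun t ht => by
      have := (hmem t).1 ht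
      rw [h] at this
      exact this
    rw [h, this]
    simp
  set a := sInf U
  set b := sSup U
  have hab : a ≤ b := csInf_le_csSup h hbb hba
  have hsub : U ⊆ Set.Icc a b := fun x hx => ⟨csInf_le hbb hx, le_csSup hba hx⟩
  have hsup : Set.Ioo a b ⊆ U :=
    IsConnected.Ioo_csInf_csSup_subset ⟨h, isPreconnected_iff_ordConnected.2 hUc⟩ hbb hba
  have hvol : (volume U).toReal = b - a := by
    have h1 : volume U ≤ ENNReal.ofReal (b - a) := (measure_mono hsub).trans (by simp)
    have h2 : ENNReal.ofReal (b - a) ≤ volume U := le_trans (by simp) (measure_mono hsup)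
    rw [le_antisymm h1 h2, ENNReal.toReal_ofReal (by linarith)]
  rw [hvol]
  have hle : F.card ≤ (Finset.Icc ⌈a⌉ ⌊b⌋).card := by
    apply Finset.card_le_card
    intro t ht
    have := hsub ((hmem t).1 ht)
    rw [Finset.mem_Icc]
    exact ⟨Int.ceil_le.2 this.1, Int.le_floor.2 this.2⟩
  have hge : (Finset.Ioo ⌊a⌋ ⌈b⌉).card ≤ F.card := by
    apply Finset.card_le_card
    intro t ht
    rw [Finset.mem_Ioo] at ht
    exact (hmem t).2 (hsup ⟨Int.floor_lt.1 ht.1, Int.lt_ceil.1 ht.2⟩)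
  rw [Int.card_Icc] at hle
  rw [Int.card_Ioo] at hge
  have h1 := Int.le_ceil a
  have h2 := Int.floor_le b
  have h3 := Int.floor_le a
  have h4 := Int.le_ceil b
  rw [abs_le]
  constructor
  · have : ((⌈b⌉ - ⌊a⌋ - 1 : ℤ) : ℝ) ≤ F.card := by
      have h5 : (⌈b⌉ - ⌊a⌋ - 1 : ℤ) ≤ F.card := (Int.self_le_toNat _).trans (by exact_mod_cast hge)
      exact_mod_cast h5
    push_cast at this
    linarith
  · have : (F.card : ℝ) ≤ b - a + 1 := by
      have h5 : (F.card : ℤ) ≤ max (⌊b⌋ + 1 - ⌈a⌉) 0 := by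
        rw [← Int.toNat_eq_max]
        exact_mod_cast hle
      rcases le_total (⌊b⌋ + 1 - ⌈a⌉) 0 with h6 | h6
      · rw [max_eq_right h6] at h5
        have : (F.card : ℝ) ≤ 0 := by exact_mod_cast h5
        linarith
      · rw [max_eq_left h6] at h5
        have : (F.card : ℝ) ≤ ((⌊b⌋ + 1 - ⌈a⌉ : ℤ) : ℝ) := by exact_mod_cast h5
        push_cast at this
        linarith
    linarith

/-- The sum of `g` over the integers of `[-Q, Q]` minus its integral over `[-Q, Q]`. -/
noncomputable def sumSubIntegral (Q : ℝ) (g : ℝ → ℝ) : ℝ :=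
  ∑ t ∈ Finset.Icc (-⌊Q⌋) ⌊Q⌋, g (t : ℝ) - ∫ t in Set.Icc (-Q) Q, g t

lemma sumSubIntegral_sum {ι : Type*} (s : Finset ι) (Q : ℝ) (g : ι → ℝ → ℝ)
    (hg : ∀ i ∈ s, IntegrableOn (g i) (Set.Icc (-Q) Q)) :
    sumSubIntegral Q (fun t => ∑ i ∈ s, g i t) = ∑ i ∈ s, sumSubIntegral Q (g i) := by
  simp only [sumSubIntegral]
  rw [integral_finsetSum _ hg, Finset.sum_comm, Finset.sum_sub_distrib]

lemma integrableOn_indicator_ordConnected {T : Set ℝ} (hT : T.OrdConnected) (Q : ℝ) :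
    IntegrableOn (T.indicator fun _ => (1 : ℝ)) (Set.Icc (-Q) Q) :=
  Integrable.indicator (by simp) hT.measurableSet

lemma abs_sumSubIntegral_indicator_le {T : Set ℝ} (hT : T.OrdConnected) (Q : ℝ) :
    |sumSubIntegral Q (T.indicator fun _ => (1 : ℝ))| ≤ 1 := by
  have h := abs_card_int_sub_volume_le hT Q
  rw [sumSubIntegral]
  have h1 : ∫ t in Set.Icc (-Q) Q, T.indicator (fun _ => (1 : ℝ)) t =
      (volume (T ∩ Set.Icc (-Q) Q)).toReal := by
    rw [integral_indicator hT.measurableSet, Measure.restrict_restrict hT.measurableSet]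
    simp [Measure.real]
  rw [h1]
  simp only [Set.indicator_apply]
  rw [← Finset.sum_filter, Finset.sum_const, nsmul_eq_mul, mul_one]
  exact h

lemma abs_sumSubIntegral_sum_indicator_le {ι : Type*} (s : Finset ι) {T : ι → Set ℝ}
    (hT : ∀ i, (T i).OrdConnected) (Q : ℝ) :
    |sumSubIntegral Q (fun t => ∑ i ∈ s, (T i).indicator (fun _ => (1 : ℝ)) t)| ≤ s.card := by
  rw [sumSubIntegral_sum _ _ _ fun i _ => integrableOn_indicator_ordConnected (hT i) Q]
  refine (Finset.abs_sum_le_sum_abs _ _).trans ?_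
  refine (Finset.sum_le_sum fun i _ => abs_sumSubIntegral_indicator_le (hT i) Q).trans ?_
  simp

lemma sumSubIntegral_add (Q : ℝ) {f g : ℝ → ℝ} (hf : IntegrableOn f (Set.Icc (-Q) Q))
    (hg : IntegrableOn g (Set.Icc (-Q) Q)) :
    sumSubIntegral Q (fun t => f t + g t) = sumSubIntegral Q f + sumSubIntegral Q g := by
  simp only [sumSubIntegral]
  rw [integral_add hf hg, Finset.sum_add_distrib]
  ring

lemma sumSubIntegral_const_mul (Q c : ℝ) (f : ℝ → ℝ) :
    sumSubIntegral Q (fun t => c * f t) = c * sumSubIntegral Q f := by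
  simp only [sumSubIntegral]
  rw [integral_const_mul, ← Finset.mul_sum]
  ring

/-! ### Roots while one coefficient varies -/

/-- The numerator of the derivative of `h / X ^ k`, after division by a power of `X`. -/
noncomputable def critPoly (h : ℝ[X]) (k : ℕ) : ℝ[X] := X * derivative h - C (k : ℝ) * h

/-- The operator kills exactly the coefficient of `X ^ k`, so `critPoly h k` vanishes only if `h` is
a multiple of the monomial `X ^ k`. -/
lemma critPoly_coeff (h : ℝ[X]) (k j : ℕ) :
    (critPoly h k).coeff j = ((j : ℝ) - k) * h.coeff j := by
  rw [critPoly, coeff_sub, coeff_C_mul]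
  cases j with
  | zero => simp
  | succ j => rw [coeff_X_mul, coeff_derivative]; push_cast; ring

/-- The points at which `h / X ^ k` is singular or critical. -/
noncomputable def critSet (h : ℝ[X]) (k : ℕ) : Finset ℝ := insert 0 (critPoly h k).roots.toFinset

lemma critSet_card_le (h : ℝ[X]) (k : ℕ) : (critSet h k).card ≤ h.natDegree + 1 := by
  refine (Finset.card_insert_le _ _).trans (Nat.succ_le_succ ?_)
  refine (Multiset.toFinset_card_le _).trans ((card_roots' _).trans ?_)
  refine natDegree_le_iff_coeff_eq_zero.2 fun j hj => ?_
  rw [critPoly_coeff, coeff_eq_zero_of_natDegree_lt hj, mul_zero]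

/-- Rolle's theorem: two equal values in a gap would force a critical point between them, but
critical points belong to `critSet`. -/
lemma injOn_gap {h : ℝ[X]} {k : ℕ} (hw : critPoly h k ≠ 0) {j : ℕ} :
    Set.InjOn (fun x => h.eval x / x ^ k) (gap (critSet h k) j) := by
  have key : ∀ x ∈ gap (critSet h k) j, ∀ y ∈ gap (critSet h k) j, x < y →
      h.eval x / x ^ k ≠ h.eval y / y ^ k := by
    intro x hx y hy hxy heq
    have hoc := (gap_ordConnected (critSet h k) j).out hx hy
    have hne : ∀ c ∈ Set.Icc x y, c ≠ 0 := by
      rintro c hc rfl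
      exact (hoc hc).1 (Finset.mem_insert_self _ _)
    have hder : ∀ c ∈ Set.Icc x y, HasDerivAt (fun x => h.eval x / x ^ k)
        (((derivative h).eval c * c ^ k - h.eval c * (k * c ^ (k - 1))) / (c ^ k) ^ 2) c := by
      intro c hc
      exact (h.hasDerivAt c).div (hasDerivAt_pow k c) (pow_ne_zero _ (hne c hc))
    obtain ⟨c, hc, hc0⟩ := exists_hasDerivAt_eq_zero hxy
      (fun c hc => (hder c hc).continuousAt.continuousWithinAt) heq
      (fun c hc => hder c (Set.Ioo_subset_Icc_self hc))
    have hc' := Set.Ioo_subset_Icc_self hc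
    have hcne := hne c hc'
    rw [div_eq_zero_iff, or_iff_left (pow_ne_zero _ (pow_ne_zero _ hcne))] at hc0
    apply (hoc hc').1
    rw [critSet, Finset.mem_insert, Multiset.mem_toFinset, mem_roots hw]
    right
    have h1 : c ^ k * (critPoly h k).eval c = 0 := by
      rw [critPoly]
      simp only [eval_sub, eval_mul, eval_X, eval_C]
      cases k with
      | zero => simp at hc0 ⊢; exact Or.inr hc0
      | succ k =>
        simp only [Nat.add_sub_cancel] at hc0
        calc _ = c * (eval c (derivative h) * c ^ (k + 1) - eval c h * ((k + 1 : ℕ) * c ^ k)) := by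
              ring
          _ = 0 := by rw [hc0, mul_zero]
    exact (mul_eq_zero.1 h1).resolve_left (pow_ne_zero _ hcne)
  intro x hx y hy heq
  rcases lt_trichotomy x y with h1 | h1 | h1
  · exact absurd heq (key x hx y hy h1)
  · exact h1
  · exact absurd heq.symm (key y hy x hx h1)

lemma ne_zero_of_mem_gap {h : ℝ[X]} {k j : ℕ} {x : ℝ} (hx : x ∈ gap (critSet h k) j) : x ≠ 0 := by
  rintro rfl
  exact hx.1 (Finset.mem_insert_self _ _)

lemma add_mul_pow_eq_zero_iff {u t x : ℝ} {k : ℕ} (hx : x ≠ 0) :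
    u + t * x ^ k = 0 ↔ -(u / x ^ k) = t := by
  rw [neg_eq_iff_eq_neg, div_eq_iff (pow_ne_zero _ hx), add_eq_zero_iff_eq_neg, neg_mul]

/-- Solving for `t` exhibits the set as the image of an interval under `x ↦ -h(x) / x ^ k`,
continuous there because `0` lies in no gap. -/
lemma ordConnected_coeff_of_root_in_gap {I : Set ℝ} (hI : I.OrdConnected) (h : ℝ[X]) (k j : ℕ) :
    {t : ℝ | ∃ x ∈ I ∩ gap (critSet h k) j, h.eval x + t * x ^ k = 0}.OrdConnected := by
  have : {t : ℝ | ∃ x ∈ I ∩ gap (critSet h k) j, h.eval x + t * x ^ k = 0} =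
      (fun x => -(h.eval x / x ^ k)) '' (I ∩ gap (critSet h k) j) := by
    ext t
    simp only [Set.mem_ofPred_eq, Set.mem_image]
    refine exists_congr fun x => and_congr_right fun hx => ?_
    exact add_mul_pow_eq_zero_iff (ne_zero_of_mem_gap hx.2)
  rw [this]
  apply IsPreconnected.ordConnected
  apply IsPreconnected.image
  · exact isPreconnected_iff_ordConnected.2 (hI.inter (gap_ordConnected _ _))
  · intro x hx
    have := ne_zero_of_mem_gap hx.2
    apply ContinuousAt.continuousWithinAt
    exact (h.continuous.continuousAt.div (continuous_pow k).continuousAt (pow_ne_zero _ this)).neg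

/-- The condition is affine in `t`, so the set is empty, a point or the whole line. -/
lemma ordConnected_coeff_of_root (I : Set ℝ) (u z : ℝ) (k : ℕ) :
    {t : ℝ | z ∈ I ∧ u + t * z ^ k = 0}.OrdConnected := by
  refine ⟨?_⟩
  rintro s ⟨hz, hs⟩ t ⟨-, ht⟩ v hv
  refine ⟨hz, ?_⟩
  have h1 : (t - s) * z ^ k = 0 := by linear_combination ht - hs
  rcases mul_eq_zero.1 h1 with h2 | h2
  · have : v = s := le_antisymm (by linarith [hv.2]) hv.1
    rw [this, hs]
  · rw [h2] at hs ⊢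
    simpa using hs

lemma critPoly_ne_zero {m : ℕ} {a : Fin m → ℝ} {k : Fin m} (ha : Function.update a k 0 ≠ 0) :
    critPoly (vecPoly (Function.update a k 0)) k ≠ 0 := by
  obtain ⟨i, hi⟩ := Function.ne_iff.1 ha
  intro h
  have h1 := critPoly_coeff (vecPoly (Function.update a k 0)) k i
  rw [h, vecPoly_coeff_fin, coeff_zero] at h1
  have hik : i ≠ k := by
    rintro rfl
    simp at hi
  have h2 : ((i : ℕ) : ℝ) - ((k : ℕ) : ℝ) ≠ 0 := by
    rw [sub_ne_zero]
    exact_mod_cast fun h => hik (Fin.ext h)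
  exact mul_ne_zero h2 hi h1.symm

/-- The finite set that cuts the line depends on the other coefficients only and not on `t`, so one
decomposition serves all `t` simultaneously. -/
lemma rootCount_update_eq_sum (I : Set ℝ) {m : ℕ} {a : Fin m → ℝ} {k : Fin m}
    (ha : Function.update a k 0 ≠ 0) (t : ℝ) :
    rootCount I (vecPoly (Function.update a k t)) =
      (∑ j ∈ Finset.range ((critSet (vecPoly (Function.update a k 0)) k).card + 1),
        if ∃ x ∈ I ∩ gap (critSet (vecPoly (Function.update a k 0)) k) j,
          (vecPoly (Function.update a k 0)).eval x + t * x ^ (k : ℕ) = 0 then 1 else 0) +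
      ∑ z ∈ critSet (vecPoly (Function.update a k 0)) k,
        if z ∈ I ∧ (vecPoly (Function.update a k 0)).eval z + t * z ^ (k : ℕ) = 0
          then 1 else 0 := by
  have hne : vecPoly (Function.update a k t) ≠ 0 := by
    rw [Ne, vecPoly_eq_zero_iff]
    intro h
    apply ha
    have := congrArg (fun b => Function.update b k 0) h
    simpa using this
  rw [rootCount_eq_sum_gap I (critSet (vecPoly (Function.update a k 0)) k) hne]
  · simp only [vecPoly_update_eval a k t]
  · intro j x hx y hy hx0 hy0
    rw [vecPoly_update_eval, add_mul_pow_eq_zero_iff (ne_zero_of_mem_gap hx.2)] at hx0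
    rw [vecPoly_update_eval, add_mul_pow_eq_zero_iff (ne_zero_of_mem_gap hy.2)] at hy0
    apply injOn_gap (critPoly_ne_zero ha) hx.2 hy.2
    exact neg_injective (hx0.trans hy0.symm)

/-- Along each coordinate, the sum of the root count over the integers of `[-Q, Q]` is within a
bounded distance of its integral. -/
lemma abs_sumSubIntegral_rootCount_le {I : Set ℝ} (hI : I.OrdConnected) {m : ℕ} (a : Fin m → ℝ)
    (k : Fin m) (Q : ℝ) :
    |sumSubIntegral Q (fun t => (rootCount I (vecPoly (Function.update a k t)) : ℝ))| ≤
      2 * m + 1 := by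
  -- Degenerate case: the polynomial is `t * X ^ k`, whose root count is a constant for `t ≠ 0` and
  -- is `0` by convention at `t = 0`.
  by_cases ha : Function.update a k 0 = 0
  · set c := rootCount I (vecPoly (Function.update a k 1)) with hc
    have hcm : (c : ℝ) ≤ m := by exact_mod_cast rootCount_vecPoly_le I _
    have hf : (fun t => (rootCount I (vecPoly (Function.update a k t)) : ℝ)) = fun t : ℝ =>
        (c : ℝ) * (Set.univ : Set ℝ).indicator (fun _ => (1 : ℝ)) t +
          (-(c : ℝ)) * ({0} : Set ℝ).indicator (fun _ => (1 : ℝ)) t := by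
      funext t
      by_cases ht : t = 0
      · rw [ht, ha, vecPoly_zero, rootCount_zero]
        simp
      · have : Function.update a k t = t • Function.update a k 1 := by
          funext i
          by_cases hi : i = k
          · subst hi
            simp
          · have h2 := congrFun ha i
            rw [Function.update_of_ne hi] at h2
            rw [Pi.smul_apply, Function.update_of_ne hi, Function.update_of_ne hi, h2]
            simp
        rw [this, vecPoly_smul, rootCount_C_mul I ht]
        simp [ht, hc]
    have hu : (Set.univ : Set ℝ).OrdConnected := Set.ordConnected_univ
    have h0 : ({0} : Set ℝ).OrdConnected := Set.ordConnected_singleton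
    rw [hf, sumSubIntegral_add, sumSubIntegral_const_mul, sumSubIntegral_const_mul]
    · have h1 := abs_sumSubIntegral_indicator_le hu Q
      have h2 := abs_sumSubIntegral_indicator_le h0 Q
      have hc0 : (0 : ℝ) ≤ c := Nat.cast_nonneg c
      refine (abs_add_le _ _).trans ?_
      rw [abs_mul, abs_mul, abs_neg, abs_of_nonneg hc0]
      nlinarith
    · exact (integrableOn_indicator_ordConnected hu Q).const_mul _
    · exact (integrableOn_indicator_ordConnected h0 Q).const_mul _
  · set h := vecPoly (Function.update a k 0) with hh
    set Z := critSet h k with hZ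
    -- With at most `m` cut points there are at most `m + 1` gaps, hence at most `2 * m + 1`
    -- indicators.
    have hZc : (Z.card : ℝ) ≤ m := by
      have h1 := critSet_card_le h k
      have h2 := vecPoly_natDegree_lt _ ha
      rw [← hZ] at h1
      rw [← hh] at h2
      exact_mod_cast (by omega : Z.card ≤ m)
    have hf : (fun t => (rootCount I (vecPoly (Function.update a k t)) : ℝ)) = fun t : ℝ =>
        (∑ j ∈ Finset.range (Z.card + 1),
          {t : ℝ | ∃ x ∈ I ∩ gap Z j, h.eval x + t * x ^ (k : ℕ) = 0}.indicator
            (fun _ => (1 : ℝ)) t) +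
        ∑ z ∈ Z, {t : ℝ | z ∈ I ∧ h.eval z + t * z ^ (k : ℕ) = 0}.indicator
          (fun _ => (1 : ℝ)) t := by
      funext t
      rw [rootCount_update_eq_sum I ha t]
      simp only [Set.indicator_apply, Set.mem_ofPred_eq, Nat.cast_add, Nat.cast_sum,
        Nat.cast_ite, Nat.cast_one, Nat.cast_zero]
      rfl
    have hT1 := fun j => ordConnected_coeff_of_root_in_gap hI h k j
    have hT2 := fun z => ordConnected_coeff_of_root I (h.eval z) z k
    rw [hf, sumSubIntegral_add]
    · have h1 := abs_sumSubIntegral_sum_indicator_le (Finset.range (Z.card + 1)) hT1 Q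
      have h2 := abs_sumSubIntegral_sum_indicator_le Z hT2 Q
      rw [Finset.card_range] at h1
      push_cast at h1
      refine (abs_add_le _ _).trans ((add_le_add h1 h2).trans ?_)
      linarith
    · exact integrable_finsetSum _ fun i _ => integrableOn_indicator_ordConnected (hT1 i) Q
    · exact integrable_finsetSum _ fun i _ => integrableOn_indicator_ordConnected (hT2 i) Q

/-! ### Measurability of the root count -/

lemma ordConnected_isLocallyClosed {S : Set ℝ} (hS : S.OrdConnected) : IsLocallyClosed S := by
  have h := (isPreconnected_iff_ordConnected.2 hS).mem_intervals
  simp only [Set.mem_insert_iff, Set.mem_singleton_iff] at h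
  rcases h with h | h | h | h | h | h | h | h | h | h <;> rw [h]
  · exact isClosed_Icc.isLocallyClosed
  · exact isLocallyClosed_Ico
  · exact isLocallyClosed_Ioc
  · exact isOpen_Ioo.isLocallyClosed
  · exact isClosed_Ici.isLocallyClosed
  · exact isOpen_Ioi.isLocallyClosed
  · exact isClosed_Iic.isLocallyClosed
  · exact isOpen_Iio.isLocallyClosed
  · exact isOpen_univ.isLocallyClosed
  · exact isOpen_empty.isLocallyClosed

lemma continuous_vecPoly_eval (m : ℕ) :
    Continuous fun q : (Fin m → ℝ) × ℝ => (vecPoly q.1).eval q.2 := by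
  simp only [vecPoly_eval]
  fun_prop

/-- A projection of a Borel set need not be Borel. Here the incidence set is locally closed, hence
σ-compact, and so is its continuous image. -/
lemma measurableSet_exists_root {S : Set ℝ} (hS : S.OrdConnected) (m : ℕ) :
    MeasurableSet {a : Fin m → ℝ | ∃ x ∈ S, (vecPoly a).eval x = 0} := by
  set L : Set ((Fin m → ℝ) × ℝ) := {q | q.2 ∈ S ∧ (vecPoly q.1).eval q.2 = 0} with hL
  have hLc : IsLocallyClosed L := by
    have h1 : IsLocallyClosed ((Prod.snd : (Fin m → ℝ) × ℝ → ℝ) ⁻¹' S) :=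
      (ordConnected_isLocallyClosed hS).preimage continuous_snd
    have h2 : IsClosed {q : (Fin m → ℝ) × ℝ | (vecPoly q.1).eval q.2 = 0} :=
      isClosed_eq (continuous_vecPoly_eval m) continuous_const
    exact h1.inter h2.isLocallyClosed
  have : LocallyCompactSpace L := hLc.locallyCompactSpace
  have hσ : IsSigmaCompact L := isSigmaCompact_iff_sigmaCompactSpace.2 inferInstance
  have himg : {a : Fin m → ℝ | ∃ x ∈ S, (vecPoly a).eval x = 0} = Prod.fst '' L := by
    ext a
    constructor
    · rintro ⟨x, hx, h0⟩
      exact ⟨(a, x), ⟨hx, h0⟩, rfl⟩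
    · rintro ⟨q, ⟨hx, h0⟩, rfl⟩
      exact ⟨q.2, hx, h0⟩
  rw [himg]
  obtain ⟨K, hK, hKL⟩ := hσ.image continuous_fst
  rw [← hKL]
  exact MeasurableSet.iUnion fun i => (hK i).measurableSet

/-- On a fine enough grid of mesh `1 / M` distinct roots fall into distinct cells. This expresses
the count through countably many conditions of the form "some root lies in a given interval". -/
lemma le_rootCount_iff (I : Set ℝ) {q : ℝ[X]} (hq : q ≠ 0) (j : ℕ) :
    j ≤ rootCount I q ↔ ∃ (M : ℕ) (K : Finset ℤ), K.card = j ∧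
      ∀ k ∈ K, ∃ x ∈ I ∩ {x | ⌊(M : ℝ) * x⌋ = k}, q.eval x = 0 := by
  set R := q.roots.toFinset.filter (· ∈ I) with hR
  have memR : ∀ x, x ∈ R ↔ x ∈ I ∧ q.eval x = 0 := by
    intro x
    simp [hR, hq, and_comm]
  change j ≤ R.card ↔ _
  constructor
  · intro hj
    have hev : ∀ᶠ M : ℕ in atTop, ∀ x ∈ R, ∀ y ∈ R, x < y → ⌊(M : ℝ) * x⌋ ≠ ⌊(M : ℝ) * y⌋ := by
      rw [Filter.eventually_all_finset]
      intro x _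
      rw [Filter.eventually_all_finset]
      intro y _
      by_cases hxy : x < y
      · have : Tendsto (fun M : ℕ => (M : ℝ) * (y - x)) atTop atTop :=
          tendsto_natCast_atTop_atTop.atTop_mul_const (by linarith)
        filter_upwards [this.eventually_ge_atTop 1] with M hM _ heq
        have h1 := Int.floor_le ((M : ℝ) * x)
        have h2 := Int.lt_floor_add_one ((M : ℝ) * y)
        rw [heq] at h1
        have := Int.lt_floor_add_one ((M : ℝ) * x)
        have := Int.floor_le ((M : ℝ) * y)
        rw [← heq] at this
        linarith
      · exact Filter.Eventually.of_forall fun M h => absurd h hxy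
    obtain ⟨M, hM⟩ := hev.exists
    have hinj : Set.InjOn (fun x : ℝ => ⌊(M : ℝ) * x⌋) R := by
      intro x hx y hy heq
      rcases lt_trichotomy x y with h | h | h
      · exact absurd heq (hM x hx y hy h)
      · exact h
      · exact absurd heq.symm (hM y hy x hx h)
    rw [← Finset.card_image_of_injOn hinj] at hj
    obtain ⟨K, hK, hKj⟩ := Finset.exists_subset_card_eq hj
    refine ⟨M, K, hKj, fun k hk => ?_⟩
    obtain ⟨x, hx, hxk⟩ := Finset.mem_image.1 (hK hk)
    exact ⟨x, ⟨((memR x).1 hx).1, hxk⟩, ((memR x).1 hx).2⟩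
  · rintro ⟨M, K, rfl, hK⟩
    have : K ⊆ R.image (fun x : ℝ => ⌊(M : ℝ) * x⌋) := by
      intro k hk
      obtain ⟨x, ⟨hxI, hxk⟩, hx0⟩ := hK k hk
      exact Finset.mem_image.2 ⟨x, (memR x).2 ⟨hxI, hx0⟩, hxk⟩
    exact (Finset.card_le_card this).trans Finset.card_image_le

lemma measurable_rootCount {I : Set ℝ} (hI : I.OrdConnected) (m : ℕ) :
    Measurable fun a : Fin m → ℝ => rootCount I (vecPoly a) := by
  apply measurable_of_Ici
  intro j
  rcases Nat.eq_zero_or_pos j with rfl | hj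
  · convert MeasurableSet.univ
    ext a
    simp
  -- The zero vector is removed because the zero polynomial vanishes everywhere while its root count
  -- is `0`.
  have : (fun a : Fin m → ℝ => rootCount I (vecPoly a)) ⁻¹' Set.Ici j =
      {0}ᶜ ∩ ⋃ (M : ℕ), ⋃ (K : Finset ℤ), ⋃ (_ : K.card = j), ⋂ k ∈ K,
        {a : Fin m → ℝ | ∃ x ∈ I ∩ {x | ⌊(M : ℝ) * x⌋ = k}, (vecPoly a).eval x = 0} := by
    ext a
    by_cases ha : a = 0
    · subst ha
      simp only [Set.mem_preimage, vecPoly_zero, rootCount_zero, Set.mem_Ici, Set.mem_inter_iff,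
        Set.mem_compl_iff, Set.mem_singleton_iff, not_true_eq_false, false_and, iff_false]
      omega
    · have hne : vecPoly a ≠ 0 := fun h => ha ((vecPoly_eq_zero_iff a).1 h)
      rw [Set.mem_preimage, Set.mem_Ici, le_rootCount_iff I hne j]
      simp [ha]
  rw [this]
  refine (MeasurableSet.singleton _).compl.inter ?_
  refine MeasurableSet.iUnion fun M => MeasurableSet.iUnion fun K => MeasurableSet.iUnion fun _ =>
    Finset.measurableSet_biInter _ fun k _ => measurableSet_exists_root ?_ m
  refine hI.inter ⟨fun x hx y hy u hu => ?_⟩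
  have h1 : ⌊(M : ℝ) * x⌋ ≤ ⌊(M : ℝ) * u⌋ := Int.floor_mono (by gcongr; exact hu.1)
  have h2 : ⌊(M : ℝ) * u⌋ ≤ ⌊(M : ℝ) * y⌋ := Int.floor_mono (by gcongr; exact hu.2)
  rw [hx] at h1
  rw [hy] at h2
  exact le_antisymm h2 h1

/-! ### Lattice points and volume in a cube -/

/-- The cube `[-Q, Q] ^ m`. -/
def box (m : ℕ) (Q : ℝ) : Set (Fin m → ℝ) := Set.univ.pi fun _ => Set.Icc (-Q) Q

/-- The integer points of the cube `[-Q, Q] ^ m`. -/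
noncomputable def intBox (m : ℕ) (Q : ℝ) : Finset (Fin m → ℤ) :=
  Fintype.piFinset fun _ => Finset.Icc (-⌊Q⌋) ⌊Q⌋

lemma measurableSet_box (m : ℕ) (Q : ℝ) : MeasurableSet (box m Q) :=
  MeasurableSet.univ_pi fun _ => measurableSet_Icc

lemma isCompact_box (m : ℕ) (Q : ℝ) : IsCompact (box m Q) :=
  isCompact_univ_pi fun _ => isCompact_Icc

lemma volume_box_real (m : ℕ) {Q : ℝ} (hQ : 0 ≤ Q) : volume.real (box m Q) = (2 * Q) ^ m := by
  rw [Measure.real, box, volume_pi_pi]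
  simp only [Real.volume_Icc, Finset.prod_const, Finset.card_univ, Fintype.card_fin,
    ENNReal.toReal_pow]
  rw [ENNReal.toReal_ofReal (by linarith)]
  ring

instance isFiniteMeasure_restrict_box (m : ℕ) (Q : ℝ) :
    IsFiniteMeasure (volume.restrict (box m Q)) :=
  ⟨by rw [Measure.restrict_apply_univ]; exact (isCompact_box m Q).measure_lt_top⟩

lemma integrableOn_box {m : ℕ} {f : (Fin m → ℝ) → ℝ} (hf : Measurable f) {B : ℝ}
    (hB : ∀ a, |f a| ≤ B) (Q : ℝ) : IntegrableOn f (box m Q) :=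
  Integrable.of_bound hf.aestronglyMeasurable B (Filter.Eventually.of_forall hB)

lemma measurePreserving_cons (m : ℕ) (Q : ℝ) :
    MeasurePreserving (MeasurableEquiv.piFinSuccAbove (fun _ : Fin (m + 1) => ℝ) 0).symm
      ((volume.restrict (Set.Icc (-Q) Q)).prod (volume.restrict (box m Q)))
      (volume.restrict (box (m + 1) Q)) := by
  have h := (measurePreserving_piFinSuccAbove
    (fun _ : Fin (m + 1) => (volume : Measure ℝ).restrict (Set.Icc (-Q) Q)) 0).symm
  have h2 : ∀ k : ℕ, Measure.pi (fun _ : Fin k => (volume : Measure ℝ).restrict (Set.Icc (-Q) Q)) =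
      volume.restrict (box k Q) := by
    intro k
    rw [box, volume_pi, Measure.restrict_pi_pi]
  rw [h2, h2] at h
  exact h

lemma piFinSuccAbove_symm_zero (m : ℕ) (p : ℝ × (Fin m → ℝ)) :
    (MeasurableEquiv.piFinSuccAbove (fun _ : Fin (m + 1) => ℝ) 0).symm p =
      (Fin.cons p.1 p.2 : Fin (m + 1) → ℝ) := by
  rw [MeasurableEquiv.piFinSuccAbove_symm_apply]
  simp [Fin.insertNthEquiv, Fin.insertNth_zero']

lemma measurable_cons (m : ℕ) :
    Measurable fun p : ℝ × (Fin m → ℝ) => (Fin.cons p.1 p.2 : Fin (m + 1) → ℝ) := by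
  have := (MeasurableEquiv.piFinSuccAbove (fun _ : Fin (m + 1) => ℝ) 0).symm.measurable
  rwa [show ((MeasurableEquiv.piFinSuccAbove (fun _ : Fin (m + 1) => ℝ) 0).symm :
    ℝ × (Fin m → ℝ) → Fin (m + 1) → ℝ) = fun p => Fin.cons p.1 p.2 from
    funext (piFinSuccAbove_symm_zero m)] at this

lemma integral_box_succ {m : ℕ} {f : (Fin (m + 1) → ℝ) → ℝ} (hf : Measurable f) {B : ℝ}
    (hB : ∀ a, |f a| ≤ B) (Q : ℝ) :
    ∫ a in box (m + 1) Q, f a =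
      ∫ b in box m Q, ∫ t in Set.Icc (-Q) Q, f (Fin.cons t b : Fin (m + 1) → ℝ) := by
  rw [← (measurePreserving_cons m Q).integral_comp']
  simp only [piFinSuccAbove_symm_zero]
  rw [integral_prod_symm]
  refine Integrable.of_bound (hf.comp (measurable_cons m)).aestronglyMeasurable B
    (Filter.Eventually.of_forall fun p => hB _)

lemma lintegral_box_succ {m : ℕ} {f : (Fin (m + 1) → ℝ) → ENNReal} (hf : Measurable f) (Q : ℝ) :
    ∫⁻ a in box (m + 1) Q, f a =
      ∫⁻ b in box m Q, ∫⁻ t in Set.Icc (-Q) Q, f (Fin.cons t b : Fin (m + 1) → ℝ) := by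
  rw [← (measurePreserving_cons m Q).lintegral_comp hf]
  simp only [piFinSuccAbove_symm_zero]
  rw [lintegral_prod_symm]
  exact (hf.comp (measurable_cons m)).aemeasurable

lemma sum_intBox_succ {m : ℕ} (f : (Fin (m + 1) → ℤ) → ℝ) (Q : ℝ) :
    ∑ a ∈ intBox (m + 1) Q, f a = ∑ t ∈ Finset.Icc (-⌊Q⌋) ⌊Q⌋, ∑ b ∈ intBox m Q,
      f (Fin.cons t b : Fin (m + 1) → ℤ) := by
  rw [← Finset.sum_product']
  refine Finset.sum_nbij' (fun a => (a 0, Fin.tail a)) (fun p => Fin.cons p.1 p.2) ?_ ?_ ?_ ?_ ?_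
  · intro a ha
    rw [intBox, Fintype.mem_piFinset] at ha
    rw [Finset.mem_product, intBox, Fintype.mem_piFinset]
    exact ⟨ha 0, fun i => ha i.succ⟩
  · intro p hp
    rw [Finset.mem_product, intBox, Fintype.mem_piFinset] at hp
    rw [intBox, Fintype.mem_piFinset]
    intro i
    refine Fin.cases ?_ (fun i => ?_) i
    · exact hp.1
    · exact hp.2 i
  · intro a _
    exact Fin.cons_self_tail a
  · intro p _
    simp
  · intro a _
    simp

lemma card_Icc_floor_le {Q : ℝ} (hQ : 1 ≤ Q) :
    ((Finset.Icc (-⌊Q⌋) ⌊Q⌋).card : ℝ) ≤ 3 * Q := by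
  have h0 : 0 ≤ ⌊Q⌋ := Int.floor_nonneg.2 (by linarith)
  rw [Int.card_Icc]
  have : ((⌊Q⌋ + 1 - -⌊Q⌋).toNat : ℤ) = 2 * ⌊Q⌋ + 1 := by omega
  have h2 : ((⌊Q⌋ + 1 - -⌊Q⌋).toNat : ℝ) = 2 * ⌊Q⌋ + 1 := by exact_mod_cast this
  rw [h2]
  linarith [Int.floor_le Q]

lemma card_intBox_le (m : ℕ) {Q : ℝ} (hQ : 1 ≤ Q) : ((intBox m Q).card : ℝ) ≤ (3 * Q) ^ m := by
  rw [intBox, Fintype.card_piFinset_const]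
  push_cast
  gcongr
  exact card_Icc_floor_le hQ

/-- If the sum over integers and the integral of `f` along each coordinate line differ by `O(1)`,
then the sum over the integer points of a cube and the integral over the cube differ by
a lower power of the side. -/
lemma abs_sum_intBox_sub_integral_le {Q : ℝ} (hQ : 1 ≤ Q) {B : ℝ} (m : ℕ) :
    ∀ f : (Fin m → ℝ) → ℝ, Measurable f → (∀ a, |f a| ≤ B) →
      (∀ a k, |sumSubIntegral Q (fun t => f (Function.update a k t))| ≤ B) →
      3 * Q * |∑ a ∈ intBox m Q, f (fun i => (a i : ℝ)) - ∫ a in box m Q, f a| ≤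
        m * B * (3 * Q) ^ m := by
  -- The factor `3 * Q` on the left keeps the exponent equal to `m`, so that `m = 0` needs no
  -- exponent `m - 1`.
  induction m with
  | zero =>
    intro f hf hB hl
    have h1 : box 0 Q = Set.univ := by
      ext a
      simp [box]
    have h2 : intBox 0 Q = {0} := by
      ext a
      rw [intBox, Fintype.mem_piFinset, Finset.mem_singleton]
      exact ⟨fun _ => Subsingleton.elim _ _, fun _ i => i.elim0⟩
    rw [h1, h2, setIntegral_univ, Finset.sum_singleton, volume_pi, Measure.pi_of_empty _ 0,
      integral_dirac]
    have : (fun i : Fin 0 => ((0 : Fin 0 → ℤ) i : ℝ)) = 0 := Subsingleton.elim _ _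
    rw [this]
    simp
  | succ m ih =>
    intro f hf hB hl
    have hB0 : 0 ≤ B := (abs_nonneg _).trans (hB 0)
    set F : ℤ → ℝ := fun t => ∫ b in box m Q, f (Fin.cons (t : ℝ) b : Fin (m + 1) → ℝ) with hF
    have hmeas : ∀ t : ℝ, Measurable fun b : Fin m → ℝ => f (Fin.cons t b : Fin (m + 1) → ℝ) :=
      fun t => hf.comp ((measurable_cons m).comp measurable_prodMk_left)
    -- With the first coordinate fixed at an integer, the induction hypothesis replaces the sum over
    -- the other coordinates by an integral.
    have hstep1 : 3 * Q * |∑ a ∈ intBox (m + 1) Q, f (fun i => (a i : ℝ)) -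
        ∑ t ∈ Finset.Icc (-⌊Q⌋) ⌊Q⌋, F t| ≤ m * B * (3 * Q) ^ (m + 1) := by
      rw [sum_intBox_succ, ← Finset.sum_sub_distrib]
      have hcast : ∀ (t : ℤ) (b : Fin m → ℤ),
          (fun i => ((Fin.cons t b : Fin (m + 1) → ℤ) i : ℝ)) =
            (Fin.cons (t : ℝ) (fun i => (b i : ℝ)) : Fin (m + 1) → ℝ) := by
        intro t b
        funext i
        refine Fin.cases ?_ (fun i => ?_) i <;> simp
      simp only [hcast]
      calc _ ≤ 3 * Q * ∑ t ∈ Finset.Icc (-⌊Q⌋) ⌊Q⌋,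
            |∑ b ∈ intBox m Q, f (Fin.cons (t : ℝ) (fun i => (b i : ℝ)) : Fin (m + 1) → ℝ) - F t| :=
            mul_le_mul_of_nonneg_left (Finset.abs_sum_le_sum_abs _ _) (by linarith)
        _ ≤ ∑ t ∈ Finset.Icc (-⌊Q⌋) ⌊Q⌋, m * B * (3 * Q) ^ m := by
            rw [Finset.mul_sum]
            refine Finset.sum_le_sum fun t _ => ?_
            refine ih (fun b => f (Fin.cons (t : ℝ) b : Fin (m + 1) → ℝ)) (hmeas t)
              (fun b => hB _) ?_
            intro b k
            have := hl (Fin.cons (t : ℝ) b) k.succ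
            simpa only [Fin.cons_update] using this
        _ ≤ 3 * Q * (m * B * (3 * Q) ^ m) := by
            rw [Finset.sum_const, nsmul_eq_mul]
            exact mul_le_mul_of_nonneg_right (card_Icc_floor_le hQ) (by positivity)
        _ = _ := by ring
    -- The first coordinate is then treated by the line estimate, integrated over the remaining
    -- ones.
    have hstep2 : |∑ t ∈ Finset.Icc (-⌊Q⌋) ⌊Q⌋, F t - ∫ a in box (m + 1) Q, f a| ≤
        B * (3 * Q) ^ m := by
      have hsum : ∑ t ∈ Finset.Icc (-⌊Q⌋) ⌊Q⌋, F t = ∫ b in box m Q,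
          ∑ t ∈ Finset.Icc (-⌊Q⌋) ⌊Q⌋, f (Fin.cons (t : ℝ) b : Fin (m + 1) → ℝ) :=
        (integral_finsetSum _
          (fun (t : ℤ) _ => integrableOn_box (hmeas (t : ℝ)) (fun b => hB _) Q)).symm
      rw [integral_box_succ hf hB, hsum, ← integral_sub]
      · rw [← Real.norm_eq_abs]
        refine le_trans (norm_setIntegral_le_of_norm_le_const (C := B)
          (isCompact_box m Q).measure_lt_top ?_) ?_
        · intro b _
          have := hl (Fin.cons 0 b) 0
          simp only [Fin.update_cons_zero] at this
          exact this
        · rw [volume_box_real m (by linarith)]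
          gcongr
          linarith
      · exact integrable_finsetSum _ fun t _ => integrableOn_box (hmeas t) (fun b => hB _) Q
      · have hint : Integrable (fun p : ℝ × (Fin m → ℝ) => f (Fin.cons p.1 p.2 : Fin (m + 1) → ℝ))
            ((volume.restrict (Set.Icc (-Q) Q)).prod (volume.restrict (box m Q))) :=
          Integrable.of_bound (hf.comp (measurable_cons m)).aestronglyMeasurable B
            (Filter.Eventually.of_forall fun p => hB _)
        exact hint.integral_prod_right
    calc _ ≤ 3 * Q * (|∑ a ∈ intBox (m + 1) Q, f (fun i => (a i : ℝ)) -
        ∑ t ∈ Finset.Icc (-⌊Q⌋) ⌊Q⌋, F t| +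
          |∑ t ∈ Finset.Icc (-⌊Q⌋) ⌊Q⌋, F t - ∫ a in box (m + 1) Q, f a|) :=
          mul_le_mul_of_nonneg_left (abs_sub_le _ _ _) (by linarith)
      _ ≤ m * B * (3 * Q) ^ (m + 1) + 3 * Q * (B * (3 * Q) ^ m) := by
          rw [mul_add]
          exact add_le_add hstep1 (mul_le_mul_of_nonneg_left hstep2 (by linarith))
      _ = _ := by push_cast; ring

/-! ### Total root counts and scaling -/

/-- The integral of the root count over the unit cube of coefficient vectors. -/
noncomputable def rootVolume (m : ℕ) (I : Set ℝ) : ℝ :=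
  ∫ a in box m 1, (rootCount I (vecPoly a) : ℝ)

/-- Scaling a polynomial does not move its roots, so only the Jacobian `Q ^ m` of the dilation
remains. -/
lemma integral_rootCount_box (m : ℕ) (I : Set ℝ) {Q : ℝ} (hQ : 0 < Q) :
    ∫ a in box m Q, (rootCount I (vecPoly a) : ℝ) = Q ^ m * rootVolume m I := by
  have h := Measure.setIntegral_comp_smul_of_pos (volume : Measure (Fin m → ℝ))
    (fun a => (rootCount I (vecPoly a) : ℝ)) (box m 1) hQ
  have hbox : Q • box m 1 = box m Q := by
    ext a
    rw [Set.mem_smul_set_iff_inv_smul_mem₀ hQ.ne']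
    simp only [box, Set.mem_univ_pi, Pi.smul_apply, smul_eq_mul, Set.mem_Icc]
    refine forall_congr' fun i => ?_
    rw [← div_eq_inv_mul, le_div_iff₀ hQ, div_le_iff₀ hQ]
    simp
  rw [hbox] at h
  simp only [vecPoly_smul, rootCount_C_mul I hQ.ne', Module.finrank_fin_fun, smul_eq_mul] at h
  rw [rootVolume, h, ← mul_assoc, mul_inv_cancel₀ (by positivity), one_mul]

/-- The total number of roots in `I` of the integer polynomials with coefficients at most `Q`. -/
noncomputable def latticeCount (m : ℕ) (I : Set ℝ) (Q : ℝ) : ℝ :=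
  ∑ a ∈ intBox m Q, (rootCount I (vecPoly fun i => (a i : ℝ)) : ℝ)

lemma rootVolume_nonneg (m : ℕ) (I : Set ℝ) : 0 ≤ rootVolume m I :=
  integral_nonneg fun _ => Nat.cast_nonneg _

lemma rootVolume_le (m : ℕ) (I : Set ℝ) : rootVolume m I ≤ m * 2 ^ m := by
  have h : ‖rootVolume m I‖ ≤ m * volume.real (box m 1) := by
    refine norm_setIntegral_le_of_norm_le_const (isCompact_box m 1).measure_lt_top ?_
    intro a _
    rw [Real.norm_eq_abs, Nat.abs_cast]
    exact_mod_cast rootCount_vecPoly_le I a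
  rw [volume_box_real m zero_le_one, mul_one] at h
  exact (le_abs_self _).trans h

lemma latticeCount_of_lt_one (m : ℕ) (I : Set ℝ) {Q : ℝ} (hQ0 : 0 ≤ Q) (hQ : Q < 1) :
    latticeCount m I Q = 0 := by
  have hf : ⌊Q⌋ = 0 := Int.floor_eq_zero_iff.2 ⟨hQ0, hQ⟩
  refine Finset.sum_eq_zero fun a ha => ?_
  have : (fun i => (a i : ℝ)) = 0 := by
    funext i
    have := Fintype.mem_piFinset.1 ha i
    rw [hf] at this
    simp at this
    simp [this]
  rw [this, vecPoly_zero, rootCount_zero, Nat.cast_zero]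

/-- The range `0 < Q < 1` is included because Möbius inversion evaluates the count at `Q / d` for
arbitrarily large `d`; there the count is `0` and the main term is itself `O(Q ^ n)`. -/
lemma exists_abs_latticeCount_sub_le (n : ℕ) : ∃ C : ℝ, 0 ≤ C ∧ ∀ I : Set ℝ, I.OrdConnected →
    ∀ Q : ℝ, 0 < Q →
      |latticeCount (n + 1) I Q - Q ^ (n + 1) * rootVolume (n + 1) I| ≤ C * Q ^ n := by
  set B : ℝ := 2 * (n + 1 : ℕ) + 1 with hB
  set C₁ : ℝ := (n + 1 : ℕ) * B * 3 ^ n with hC₁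
  set C₂ : ℝ := (n + 1 : ℕ) * 2 ^ (n + 1) with hC₂
  refine ⟨max C₁ C₂, le_max_of_le_left (by positivity), fun I hI Q hQ => ?_⟩
  rcases le_or_gt 1 Q with h1 | h1
  · refine le_trans ?_ (mul_le_mul_of_nonneg_right (le_max_left _ _) (by positivity))
    have h := abs_sum_intBox_sub_integral_le h1 (B := B) (n + 1)
      (fun a => (rootCount I (vecPoly a) : ℝ))
      (measurable_from_top.comp (measurable_rootCount hI (n + 1))) ?_ ?_
    · rw [integral_rootCount_box _ _ hQ] at h
      have h3 : (0 : ℝ) < 3 * Q := by linarith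
      refine le_of_mul_le_mul_left (h.trans (le_of_eq ?_)) h3
      rw [hC₁]
      ring
    · intro a
      have : (rootCount I (vecPoly a) : ℝ) ≤ (n + 1 : ℕ) := by
        exact_mod_cast rootCount_vecPoly_le I a
      rw [Nat.abs_cast, hB]
      have h0 : (0 : ℝ) ≤ (n + 1 : ℕ) := Nat.cast_nonneg _
      linarith
    · intro a k
      exact abs_sumSubIntegral_rootCount_le hI a k Q
  · refine le_trans ?_ (mul_le_mul_of_nonneg_right (le_max_right _ _) (by positivity))
    have h0 := rootVolume_nonneg (n + 1) I
    rw [latticeCount_of_lt_one _ _ hQ.le h1, zero_sub, abs_neg, abs_of_nonneg (by positivity)]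
    have h2 := rootVolume_le (n + 1) I
    calc Q ^ (n + 1) * rootVolume (n + 1) I ≤ Q ^ n * C₂ := by
          apply mul_le_mul _ h2 h0 (by positivity)
          exact pow_le_pow_of_le_one hQ.le h1.le (Nat.le_succ n)
      _ = _ := mul_comm _ _

/-! ### The density as an integral -/

/-- The integrand of the (unnormalised) density: the polynomial is `t + x * b(x)`. -/
noncomputable def densityKernel {n : ℕ} (b : Fin n → ℝ) (x : ℝ) : ℝ :=
  (Set.Icc (-1 : ℝ) 1).indicator (fun _ => |(derivative (X * vecPoly b)).eval x|)
    (-(X * vecPoly b).eval x)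

/-- The unnormalised density of real algebraic numbers of degree `n`. -/
noncomputable def rootDensity (n : ℕ) (x : ℝ) : ℝ := ∫ b in box n 1, densityKernel b x

lemma densityKernel_nonneg {n : ℕ} (b : Fin n → ℝ) (x : ℝ) : 0 ≤ densityKernel b x :=
  Set.indicator_nonneg (fun _ _ => abs_nonneg _) _

lemma continuous_deriv_eval (n : ℕ) : Continuous fun q : (Fin n → ℝ) × ℝ =>
    (derivative (X * vecPoly q.1)).eval q.2 := by
  have : ∀ q : (Fin n → ℝ) × ℝ, (derivative (X * vecPoly q.1)).eval q.2 =
      ∑ i : Fin n, q.1 i * ((i : ℕ) + 1) * q.2 ^ (i : ℕ) := by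
    intro q
    rw [vecPoly, Finset.mul_sum, derivative_sum, eval_finsetSum]
    refine Finset.sum_congr rfl fun i _ => ?_
    rw [X_mul_monomial, derivative_monomial, eval_monomial]
    simp
  simp only [this]
  fun_prop

lemma continuous_X_mul_eval (n : ℕ) : Continuous fun q : (Fin n → ℝ) × ℝ =>
    (X * vecPoly q.1).eval q.2 := by
  simp only [eval_mul, eval_X]
  exact continuous_snd.mul (continuous_vecPoly_eval n)

lemma measurable_densityKernel (n : ℕ) :
    Measurable fun q : (Fin n → ℝ) × ℝ => densityKernel q.1 q.2 := by
  have hS : MeasurableSet {q : (Fin n → ℝ) × ℝ | -(X * vecPoly q.1).eval q.2 ∈ Set.Icc (-1 : ℝ) 1} :=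
    (continuous_X_mul_eval n).neg.measurable measurableSet_Icc
  exact (continuous_deriv_eval n).abs.measurable.indicator hS

lemma cons_eq_update {n : ℕ} (t : ℝ) (b : Fin n → ℝ) :
    (Fin.cons t b : Fin (n + 1) → ℝ) = Function.update (Fin.cons 0 b : Fin (n + 1) → ℝ) 0 t := by
  rw [Fin.update_cons_zero]

lemma vecPoly_cons_zero {n : ℕ} (b : Fin n → ℝ) :
    vecPoly (Fin.cons 0 b : Fin (n + 1) → ℝ) = X * vecPoly b := by
  ext j
  cases j with
  | zero => rw [vecPoly_coeff]; simp
  | succ j =>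
    rw [coeff_X_mul, vecPoly_coeff, vecPoly_coeff]
    by_cases h : j < n
    · rw [dif_pos h, dif_pos (Nat.succ_lt_succ h)]
      exact Fin.cons_succ (α := fun _ => ℝ) 0 b ⟨j, h⟩
    · rw [dif_neg h, dif_neg (fun h' => h (Nat.lt_of_succ_lt_succ h'))]

/-- The area formula for the number of real solutions of `t + x * b(x) = 0`. -/
lemma lintegral_rootCount_cons {I : Set ℝ} (hI : I.OrdConnected) {n : ℕ} (b : Fin n → ℝ) :
    ∫⁻ t in Set.Icc (-1 : ℝ) 1,
      (rootCount I (vecPoly (Fin.cons t b : Fin (n + 1) → ℝ)) : ENNReal) =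
        ∫⁻ x in I, ENNReal.ofReal (densityKernel b x) := by
  by_cases hb : b = 0
  · subst hb
    have h1 : ∀ t : ℝ, rootCount I (vecPoly (Fin.cons t (0 : Fin n → ℝ) : Fin (n + 1) → ℝ)) = 0 := by
      intro t
      have : vecPoly (Fin.cons t (0 : Fin n → ℝ) : Fin (n + 1) → ℝ) = C t := by
        ext j
        rw [vecPoly_coeff, coeff_C]
        cases j with
        | zero => simp
        | succ j =>
          rw [if_neg (Nat.succ_ne_zero j)]
          split_ifs with h
          · exact Fin.cons_succ (α := fun _ => ℝ) t 0 ⟨j, Nat.lt_of_succ_lt_succ h⟩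
          · rfl
      rw [this, rootCount, roots_C]
      simp
    have h2 : ∀ x : ℝ, densityKernel (0 : Fin n → ℝ) x = 0 := by
      intro x
      simp [densityKernel, vecPoly_zero]
    simp [h1, h2]
  set h : ℝ[X] := X * vecPoly b with hh
  have hupd : vecPoly (Function.update (Fin.cons 0 b : Fin (n + 1) → ℝ) 0 0) = h := by
    rw [Fin.update_cons_zero, vecPoly_cons_zero]
  have hne : Function.update (Fin.cons 0 b : Fin (n + 1) → ℝ) 0 0 ≠ 0 := by
    rw [Ne, ← vecPoly_eq_zero_iff, hupd]
    exact mul_ne_zero X_ne_zero fun h => hb ((vecPoly_eq_zero_iff b).1 h)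
  -- With `k = 0` the cut points are `0` and the critical points of `h`, so `x ↦ -h(x)`, which gives
  -- the constant term having `x` as a root, is injective on each gap.
  set Z := critSet h 0 with hZ
  have hcrit : critPoly h 0 ≠ 0 := by
    have := critPoly_ne_zero hne
    rwa [hupd] at this
  have hgapm : ∀ j, MeasurableSet (I ∩ gap Z j) := fun j =>
    (hI.inter (gap_ordConnected Z j)).measurableSet
  have hT : ∀ j, {t : ℝ | ∃ x ∈ I ∩ gap Z j, h.eval x + t * x ^ 0 = 0} =
      (fun x => -h.eval x) '' (I ∩ gap Z j) := by
    intro j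
    ext t
    simp only [Set.mem_ofPred_eq, Set.mem_image]
    refine exists_congr fun x => and_congr_right fun _ => ?_
    rw [pow_zero, mul_one, add_eq_zero_iff_neg_eq]
  have hcount : ∀ t : ℝ, (rootCount I (vecPoly (Fin.cons t b : Fin (n + 1) → ℝ)) : ENNReal) =
      (∑ j ∈ Finset.range (Z.card + 1),
        ((fun x => -h.eval x) '' (I ∩ gap Z j)).indicator (fun _ => (1 : ENNReal)) t) +
      ∑ z ∈ Z, {t : ℝ | z ∈ I ∧ h.eval z + t * z ^ 0 = 0}.indicator
          (fun _ => (1 : ENNReal)) t := by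
    intro t
    rw [cons_eq_update, rootCount_update_eq_sum I hne t, hupd]
    simp only [← hT, Set.indicator_apply, Set.mem_ofPred_eq, Nat.cast_add, Nat.cast_sum,
      Nat.cast_ite, Nat.cast_one, Nat.cast_zero]
    rfl
  have hTm : ∀ j, MeasurableSet ((fun x => -h.eval x) '' (I ∩ gap Z j)) := by
    intro j
    rw [← hT]
    exact (ordConnected_coeff_of_root_in_gap hI h 0 j).measurableSet
  have hzm : ∀ z, MeasurableSet {t : ℝ | z ∈ I ∧ h.eval z + t * z ^ 0 = 0} := fun z =>
    (ordConnected_coeff_of_root I (h.eval z) z 0).measurableSet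
  -- Change of variables `t = -h(x)` on one gap; the Jacobian is `|h'(x)|` and the constraint `t ∈
  -- [-1, 1]` becomes the indicator in the kernel.
  have hpiece : ∀ j, ∫⁻ t in Set.Icc (-1 : ℝ) 1,
      ((fun x => -h.eval x) '' (I ∩ gap Z j)).indicator (fun _ => (1 : ENNReal)) t =
        ∫⁻ x in I ∩ gap Z j, ENNReal.ofReal (densityKernel b x) := by
    intro j
    have hinj : Set.InjOn (fun x => -h.eval x) (I ∩ gap Z j) := by
      intro x hx y hy hxy
      refine injOn_gap hcrit hx.2 hy.2 ?_
      simpa using hxy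
    have hder : ∀ x ∈ I ∩ gap Z j, HasDerivWithinAt (fun x => -h.eval x)
        (-(derivative h).eval x) (I ∩ gap Z j) x := fun x _ =>
      (h.hasDerivAt x).neg.hasDerivWithinAt
    have harea := lintegral_image_eq_lintegral_abs_deriv_mul (hgapm j) hder hinj
      ((Set.Icc (-1 : ℝ) 1).indicator fun _ => (1 : ENNReal))
    rw [lintegral_indicator measurableSet_Icc, Measure.restrict_restrict measurableSet_Icc] at harea
    rw [lintegral_indicator (hTm j), Measure.restrict_restrict (hTm j), Set.inter_comm, harea]
    refine lintegral_congr fun x => ?_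
    rw [densityKernel, ← hh, abs_neg]
    by_cases hx : -h.eval x ∈ Set.Icc (-1 : ℝ) 1
    · rw [Set.indicator_of_mem hx, Set.indicator_of_mem hx, mul_one]
    · rw [Set.indicator_of_notMem hx, Set.indicator_of_notMem hx, mul_zero, ENNReal.ofReal_zero]
  -- A given cut point is a root for a single value of `t`, which has measure zero.
  have hpoint : ∀ z, ∫⁻ t in Set.Icc (-1 : ℝ) 1,
      {t : ℝ | z ∈ I ∧ h.eval z + t * z ^ 0 = 0}.indicator (fun _ => (1 : ENNReal)) t = 0 := by
    intro z
    rw [lintegral_indicator (hzm z), lintegral_one, Measure.restrict_apply_univ]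
    refine le_antisymm ?_ zero_le
    refine (Measure.restrict_apply_le _ _).trans ?_
    have : {t : ℝ | z ∈ I ∧ h.eval z + t * z ^ 0 = 0} ⊆ {-h.eval z} := by
      rintro t ⟨-, ht⟩
      rw [pow_zero, mul_one] at ht
      rw [Set.mem_singleton_iff]
      linarith
    exact (measure_mono this).trans (by simp)
  simp only [hcount]
  rw [lintegral_add_left, lintegral_finsetSum, lintegral_finsetSum]
  · simp only [hpiece, hpoint, Finset.sum_const_zero, add_zero]
    rw [← lintegral_biUnion_finset]
    · apply setLIntegral_congr
      have hdiff : ⋃ j ∈ Finset.range (Z.card + 1), I ∩ gap Z j = I \ Z := by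
        ext x
        simp only [Set.mem_iUnion, Set.mem_inter_iff, Set.mem_sdiff, Finset.mem_coe]
        constructor
        · rintro ⟨j, -, hx, hg⟩
          exact ⟨hx, hg.1⟩
        · rintro ⟨hx, hxZ⟩
          exact ⟨_, Finset.mem_range.2 (Nat.lt_succ_of_le (Finset.card_filter_le _ _)), hx, hxZ, rfl⟩
      rw [hdiff]
      exact sdiff_null_ae_eq_self (Z.finite_toSet.measure_zero _)
    · intro i _ j _ hij
      rw [Function.onFun, Set.disjoint_left]
      rintro x ⟨-, hx⟩ ⟨-, hx'⟩
      exact hij (hx.2.symm.trans hx'.2)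
    · exact fun j _ => hgapm j
  · exact fun z _ => measurable_const.indicator (hzm z)
  · exact fun j _ => measurable_const.indicator (hTm j)
  · exact Finset.measurable_fun_sum _ fun j _ => measurable_const.indicator (hTm j)

lemma integrableOn_densityKernel {n : ℕ} (x : ℝ) :
    IntegrableOn (fun b : Fin n → ℝ => densityKernel b x) (box n 1) := by
  obtain ⟨B, hB⟩ := (isCompact_box n 1).exists_bound_of_continuousOn (f := fun b : Fin n → ℝ =>
    (derivative (X * vecPoly b)).eval x)
    ((continuous_deriv_eval n).comp (by fun_prop : Continuous fun b : Fin n → ℝ => (b, x))).continuousOn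
  refine Integrable.mono' (g := fun _ => B) (integrable_const _)
    ((measurable_densityKernel n).comp measurable_prodMk_right).aestronglyMeasurable ?_
  refine (ae_restrict_mem (measurableSet_box n 1)).mono fun b hb => ?_
  refine le_trans ?_ (hB b hb)
  rw [densityKernel]
  refine (norm_indicator_le_norm_self _ _).trans ?_
  simp

lemma ofReal_rootDensity {n : ℕ} (x : ℝ) :
    ENNReal.ofReal (rootDensity n x) = ∫⁻ b in box n 1, ENNReal.ofReal (densityKernel b x) :=
  ofReal_integral_eq_lintegral_ofReal (integrableOn_densityKernel x)
    (Filter.Eventually.of_forall fun b => densityKernel_nonneg b x)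

lemma rootDensity_nonneg (n : ℕ) (x : ℝ) : 0 ≤ rootDensity n x :=
  integral_nonneg fun b => densityKernel_nonneg b x

/-- Tonelli: integrate over the constant term first, apply the area formula, then exchange the
integrals over `b` and `x`. -/
lemma lintegral_rootDensity {I : Set ℝ} (hI : I.OrdConnected) (n : ℕ) :
    ∫⁻ x in I, ENNReal.ofReal (rootDensity n x) = ENNReal.ofReal (rootVolume (n + 1) I) := by
  have hmeas : Measurable fun a : Fin (n + 1) → ℝ => rootCount I (vecPoly a) :=
    measurable_rootCount hI (n + 1)
  have h1 : ENNReal.ofReal (rootVolume (n + 1) I) =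
      ∫⁻ a in box (n + 1) 1, (rootCount I (vecPoly a) : ENNReal) := by
    rw [rootVolume, ofReal_integral_eq_lintegral_ofReal]
    · simp
    · refine integrableOn_box (f := fun a => (rootCount I (vecPoly a) : ℝ)) (B := (n + 1 : ℕ))
        (measurable_from_top.comp hmeas) (fun a => ?_) 1
      rw [Nat.abs_cast]
      exact_mod_cast rootCount_vecPoly_le I a
    · exact Filter.Eventually.of_forall fun a => Nat.cast_nonneg _
  rw [h1, lintegral_box_succ (f := fun a => (rootCount I (vecPoly a) : ENNReal))
    (measurable_from_top.comp hmeas)]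
  simp only [lintegral_rootCount_cons hI, ofReal_rootDensity]
  rw [lintegral_lintegral_swap]
  exact ((measurable_densityKernel n).ennreal_ofReal.comp measurable_swap).aemeasurable

lemma volume_linear_level_eq_zero {n : ℕ} (L : (Fin n → ℝ) →ₗ[ℝ] ℝ) (hL : L ≠ 0) (c : ℝ) :
    volume {b | L b = c} = 0 := by
  rcases Set.eq_empty_or_nonempty {b | L b = c} with h | ⟨v, hv⟩
  · rw [h, measure_empty]
  have hset : {b | L b = c} = (fun b => b + -v) ⁻¹' (LinearMap.ker L : Set (Fin n → ℝ)) := by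
    ext b
    have hv' : L v = c := hv
    simp only [Set.mem_ofPred_eq, Set.mem_preimage, SetLike.mem_coe, LinearMap.mem_ker, map_add,
      map_neg, hv']
    constructor <;> intro h <;> linarith
  rw [hset, measure_preimage_add_right]
  refine Measure.addHaar_submodule _ _ fun h => hL (LinearMap.ker_eq_top.1 h)

/-- Dominated convergence: the kernel can be discontinuous at `x₀` only if `|x₀ * b(x₀)| = 1`, which
confines `b` to two level sets of a linear form, a null set. -/
lemma continuous_rootDensity (n : ℕ) : Continuous (rootDensity n) := by
  refine continuous_iff_continuousAt.2 fun x₀ => ?_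
  obtain ⟨B, hB⟩ := ((isCompact_box n 1).prod (isCompact_closedBall x₀ 1)).exists_bound_of_continuousOn
    (continuous_deriv_eval n).continuousOn
  refine continuousAt_of_dominated (bound := fun _ => B) ?_ ?_ (integrable_const _) ?_
  · exact Filter.Eventually.of_forall fun x =>
      ((measurable_densityKernel n).comp measurable_prodMk_right).aestronglyMeasurable
  · filter_upwards [Metric.closedBall_mem_nhds x₀ one_pos] with x hx
    refine (ae_restrict_mem (measurableSet_box n 1)).mono fun b hb => ?_
    refine le_trans ?_ (hB (b, x) ⟨hb, hx⟩)
    rw [densityKernel]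
    refine (norm_indicator_le_norm_self _ _).trans ?_
    simp
  · apply ae_restrict_of_ae
    have hnull : ∀ᵐ b : Fin n → ℝ, |(X * vecPoly b).eval x₀| ≠ 1 := by
      set L : (Fin n → ℝ) →ₗ[ℝ] ℝ := ∑ i : Fin n, (x₀ * x₀ ^ (i : ℕ)) • LinearMap.proj i with hLdef
      have hLe : ∀ b, L b = (X * vecPoly b).eval x₀ := by
        intro b
        simp only [hLdef, eval_mul, eval_X, vecPoly_eval, Finset.mul_sum, LinearMap.sum_apply,
          LinearMap.smul_apply, LinearMap.proj_apply, smul_eq_mul]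
        exact Finset.sum_congr rfl fun i _ => by ring
      -- If the form vanishes (as at `x₀ = 0`), its value is never `±1`.
      by_cases hL : L = 0
      · refine Filter.Eventually.of_forall fun b => ?_
        rw [← hLe, hL]
        simp
      · have h1 := measure_eq_zero_iff_ae_notMem.1 (volume_linear_level_eq_zero L hL 1)
        have h2 := measure_eq_zero_iff_ae_notMem.1 (volume_linear_level_eq_zero L hL (-1))
        filter_upwards [h1, h2] with b hb1 hb2 habs
        rw [← hLe] at habs
        rcases eq_or_eq_neg_of_abs_eq habs with h | h
        · exact hb1 h
        · exact hb2 h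
    filter_upwards [hnull] with b hb
    have hc : ContinuousAt (fun x => (X * vecPoly b).eval x) x₀ :=
      (X * vecPoly b).continuous.continuousAt
    have hd : ContinuousAt (fun x => |(derivative (X * vecPoly b)).eval x|) x₀ :=
      (derivative (X * vecPoly b)).continuous.abs.continuousAt
    rcases lt_or_gt_of_ne hb with hlt | hgt
    · refine hd.congr ?_
      filter_upwards [hc.abs.eventually_lt_const hlt] with x hx
      rw [densityKernel, Set.indicator_of_mem]
      have := abs_lt.1 hx
      exact ⟨by linarith, by linarith⟩
    · refine (continuousAt_const (y := (0 : ℝ))).congr ?_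
      filter_upwards [hc.abs.eventually_const_lt hgt] with x hx
      rw [densityKernel, Set.indicator_of_notMem]
      intro hmem
      have : |(X * vecPoly b).eval x| ≤ 1 := abs_le.2 ⟨by linarith [hmem.2], by linarith [hmem.1]⟩
      linarith

lemma integrable_rootDensity (n : ℕ) : Integrable (rootDensity n) := by
  refine ⟨(continuous_rootDensity n).aestronglyMeasurable, ?_⟩
  rw [hasFiniteIntegral_iff_ofReal (Filter.Eventually.of_forall (rootDensity_nonneg n)),
    ← setLIntegral_univ, lintegral_rootDensity Set.ordConnected_univ]
  exact ENNReal.ofReal_lt_top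

lemma setIntegral_rootDensity {I : Set ℝ} (hI : I.OrdConnected) (n : ℕ) :
    ∫ x in I, rootDensity n x = rootVolume (n + 1) I := by
  rw [integral_eq_lintegral_of_nonneg_ae (Filter.Eventually.of_forall (rootDensity_nonneg n))
    (continuous_rootDensity n).aestronglyMeasurable, lintegral_rootDensity hI,
    ENNReal.toReal_ofReal (rootVolume_nonneg _ _)]

/-- At `x = 0` the kernel reduces to `|b 0|`, which is nonzero off a hyperplane. By continuity this
one positive value makes the total mass positive. -/
lemma rootDensity_zero_pos {n : ℕ} (hn : 1 ≤ n) : 0 < rootDensity n 0 := by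
  obtain ⟨n, rfl⟩ : ∃ k, n = k + 1 := ⟨n - 1, by omega⟩
  have hk : ∀ b : Fin (n + 1) → ℝ, densityKernel b 0 = |b 0| := by
    intro b
    rw [densityKernel, Set.indicator_of_mem]
    · have h0 : (vecPoly b).eval 0 = b 0 := by
        rw [← coeff_zero_eq_eval_zero]
        exact vecPoly_coeff_fin b 0
      simp [derivative_mul, h0]
    · simp
  rw [rootDensity, setIntegral_pos_iff_support_of_nonneg_ae
    (Filter.Eventually.of_forall fun b => densityKernel_nonneg b 0) (integrableOn_densityKernel 0)]
  have hnull : volume {b : Fin (n + 1) → ℝ | LinearMap.proj (R := ℝ) (φ := fun _ => ℝ) 0 b = 0} = 0 := by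
    refine volume_linear_level_eq_zero _ (fun h => ?_) 0
    have := LinearMap.congr_fun h (fun _ => (1 : ℝ))
    simp at this
  have hset : Function.support (fun b : Fin (n + 1) → ℝ => densityKernel b 0) ∩ box (n + 1) 1 =
      box (n + 1) 1 \ {b : Fin (n + 1) → ℝ | LinearMap.proj (R := ℝ) (φ := fun _ => ℝ) 0 b = 0} := by
    ext b
    simp [hk, and_comm]
  rw [hset, measure_sdiff_null hnull]
  refine pos_iff_ne_zero.2 fun h => ?_
  have h1 := (measureReal_eq_zero_iff (μ := volume) (s := box (n + 1) 1)
    (isCompact_box _ _).measure_lt_top.ne).2 h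
  rw [volume_box_real _ zero_le_one] at h1
  norm_num at h1

lemma rootVolume_univ_pos {n : ℕ} (hn : 1 ≤ n) : 0 < rootVolume (n + 1) Set.univ := by
  rw [← setIntegral_rootDensity Set.ordConnected_univ, setIntegral_univ,
    integral_pos_iff_support_of_nonneg (rootDensity_nonneg n) (integrable_rootDensity n)]
  exact (continuous_rootDensity n).isOpen_support.measure_pos _
    ⟨0, (rootDensity_zero_pos hn).ne'⟩

lemma hasDerivAt_rootVolume_Iic (n : ℕ) (x : ℝ) :
    HasDerivAt (fun y => rootVolume (n + 1) (Set.Iic y)) (rootDensity n x) x := by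
  have h1 : ∀ y, rootVolume (n + 1) (Set.Iic y) =
      rootVolume (n + 1) (Set.Iic 0) + ∫ u in (0 : ℝ)..y, rootDensity n u := by
    intro y
    rw [← setIntegral_rootDensity Set.ordConnected_Iic, ← setIntegral_rootDensity Set.ordConnected_Iic,
      ← intervalIntegral.integral_Iic_sub_Iic (integrable_rootDensity n).integrableOn
        (integrable_rootDensity n).integrableOn]
    ring
  rw [show (fun y => rootVolume (n + 1) (Set.Iic y)) = fun y =>
    rootVolume (n + 1) (Set.Iic 0) + ∫ u in (0 : ℝ)..y, rootDensity n u from funext h1]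
  exact ((continuous_rootDensity n).integral_hasStrictDerivAt 0 x).hasDerivAt.const_add _

/-! ### Primitive polynomials -/

open scoped ArithmeticFunction.Moebius

lemma mem_intBox {m : ℕ} {Q : ℝ} {a : Fin m → ℤ} : a ∈ intBox m Q ↔ ∀ i, |(a i : ℝ)| ≤ Q := by
  rw [intBox, Fintype.mem_piFinset]
  refine forall_congr' fun i => ?_
  rw [Finset.mem_Icc, abs_le, Int.le_floor, neg_le, Int.le_floor]
  push_cast
  rw [neg_le]

lemma vecPoly_isPrimitive_iff {m : ℕ} (a : Fin m → ℤ) :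
    (vecPoly a).IsPrimitive ↔ (Finset.univ.gcd a).natAbs = 1 := by
  rw [← Int.isUnit_iff_natAbs_eq]
  constructor
  · intro h
    apply h
    rw [C_dvd_iff_dvd_coeff]
    intro j
    rw [vecPoly_coeff]
    split_ifs with hj
    · exact Finset.gcd_dvd (Finset.mem_univ _)
    · exact dvd_zero _
  · intro h r hr
    rw [C_dvd_iff_dvd_coeff] at hr
    refine isUnit_of_dvd_unit (Finset.dvd_gcd fun i _ => ?_) h
    rw [← vecPoly_coeff_fin a i]
    exact hr i

/-- The total number of roots in `I` of the primitive integer polynomials with coefficients at most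
`Q`. -/
noncomputable def primitiveCount (m : ℕ) (I : Set ℝ) (Q : ℝ) : ℝ :=
  ∑ a ∈ (intBox m Q).filter (fun a => (vecPoly a).IsPrimitive),
    (rootCount I (vecPoly fun i => (a i : ℝ)) : ℝ)

/-- Multiplication by `d` maps the integer points of the cube for `Q / d` onto those for `Q` with
all entries divisible by `d`, without changing roots. -/
lemma latticeCount_div (m : ℕ) (I : Set ℝ) (Q : ℝ) {d : ℕ} (hd : 0 < d) :
    latticeCount m I (Q / d) = ∑ a ∈ intBox m Q,
      if d ∣ (Finset.univ.gcd a).natAbs then (rootCount I (vecPoly fun i => (a i : ℝ)) : ℝ)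
        else 0 := by
  have hd' : (0 : ℝ) < d := Nat.cast_pos.2 hd
  have hdvd : ∀ a : Fin m → ℤ, d ∣ (Finset.univ.gcd a).natAbs ↔ ∀ i, (d : ℤ) ∣ a i := by
    intro a
    rw [← Int.natCast_dvd, Finset.dvd_gcd_iff]
    simp
  rw [latticeCount, ← Finset.sum_filter]
  refine Finset.sum_nbij' (fun b i => d * b i) (fun a i => a i / d) ?_ ?_ ?_ ?_ ?_
  · intro b hb
    rw [mem_intBox] at hb
    rw [Finset.mem_filter, mem_intBox, hdvd]
    refine ⟨fun i => ?_, fun i => dvd_mul_right _ _⟩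
    have := (le_div_iff₀ hd').1 (hb i)
    push_cast
    rwa [abs_mul, Nat.abs_cast, mul_comm]
  · intro a ha
    rw [Finset.mem_filter, mem_intBox, hdvd] at ha
    rw [mem_intBox]
    intro i
    rw [le_div_iff₀ hd']
    refine le_trans (le_of_eq ?_) (ha.1 i)
    conv_rhs => rw [← Int.ediv_mul_cancel (ha.2 i)]
    push_cast
    rw [abs_mul, Nat.abs_cast]
  · intro b _
    funext i
    exact Int.mul_ediv_cancel_left _ (by exact_mod_cast hd.ne')
  · intro a ha
    rw [Finset.mem_filter, mem_intBox, hdvd] at ha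
    funext i
    exact Int.mul_ediv_cancel' (ha.2 i)
  · intro b _
    have : (fun i => (((d : ℤ) * b i : ℤ) : ℝ)) = (d : ℝ) • fun i => (b i : ℝ) := by
      funext i
      simp
    rw [this, vecPoly_smul, rootCount_C_mul I hd'.ne']

lemma sum_divisors_moebius (N : ℕ) : ∑ d ∈ N.divisors, (μ d : ℝ) = if N = 1 then 1 else 0 := by
  have h := ArithmeticFunction.moebius_mul_coe_zeta
  have h1 := congrArg (fun f : ArithmeticFunction ℤ => f N) h
  simp only [ArithmeticFunction.coe_mul_zeta_apply, ArithmeticFunction.one_apply] at h1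
  exact_mod_cast h1

/-- Möbius inversion for the count of primitive polynomials. -/
lemma primitiveCount_eq_sum (m : ℕ) (I : Set ℝ) {Q : ℝ} {D : ℕ} (hD : Q ≤ D) :
    primitiveCount m I Q = ∑ d ∈ Finset.Icc 1 D, (μ d : ℝ) * latticeCount m I (Q / d) := by
  have h1 : ∀ d ∈ Finset.Icc 1 D, (μ d : ℝ) * latticeCount m I (Q / d) = ∑ a ∈ intBox m Q,
      (rootCount I (vecPoly fun i => (a i : ℝ)) : ℝ) *
        if d ∣ (Finset.univ.gcd a).natAbs then (μ d : ℝ) else 0 := by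
    intro d hd
    rw [latticeCount_div m I Q (Finset.mem_Icc.1 hd).1, Finset.mul_sum]
    refine Finset.sum_congr rfl fun a _ => ?_
    split_ifs <;> ring
  rw [Finset.sum_congr rfl h1, Finset.sum_comm, primitiveCount, Finset.sum_filter]
  refine Finset.sum_congr rfl fun a ha => ?_
  rw [← Finset.mul_sum, vecPoly_isPrimitive_iff]
  -- The gcd of the zero vector is `0`, divisible by every `d`; its root count is `0`, so it
  -- contributes nothing.
  by_cases h0 : a = 0
  · subst h0
    have : (fun i : Fin m => (((0 : Fin m → ℤ) i : ℤ) : ℝ)) = 0 := by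
      funext i
      simp
    rw [this, vecPoly_zero, rootCount_zero]
    simp
  · obtain ⟨i, hi⟩ := Function.ne_iff.1 h0
    set N := (Finset.univ.gcd a).natAbs with hN
    have hNd : N ∣ (a i).natAbs := Int.natAbs_dvd_natAbs.2 (Finset.gcd_dvd (Finset.mem_univ i))
    have hai : 0 < (a i).natAbs := Int.natAbs_pos.2 hi
    have hNpos : 0 < N := Nat.pos_of_dvd_of_pos hNd hai
    have hND : N ≤ D := by
      refine (Nat.le_of_dvd hai hNd).trans ?_
      have := (mem_intBox.1 ha i).trans hD
      rw [← Int.cast_abs, Int.abs_eq_natAbs] at this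
      exact_mod_cast this
    have hdiv : (Finset.Icc 1 D).filter (fun d => d ∣ N) = N.divisors := by
      ext d
      rw [Finset.mem_filter, Finset.mem_Icc, Nat.mem_divisors]
      constructor
      · rintro ⟨-, h⟩
        exact ⟨h, hNpos.ne'⟩
      · rintro ⟨h, -⟩
        exact ⟨⟨Nat.pos_of_dvd_of_pos h hNpos, (Nat.le_of_dvd hNpos h).trans hND⟩, h⟩
    rw [← Finset.sum_filter, hdiv, sum_divisors_moebius]
    split_ifs <;> simp

/-- The proportion `∑ μ(d) / d ^ k` of primitive vectors. -/
noncomputable def primitiveDensity (k : ℕ) : ℝ := ∑' d : ℕ, (μ d : ℝ) / (d : ℝ) ^ k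

lemma abs_moebius_real_le_one (d : ℕ) : |(μ d : ℝ)| ≤ 1 := by
  exact_mod_cast (ArithmeticFunction.abs_moebius_le_one (n := d))

lemma abs_moebius_div_pow_le (k d : ℕ) : |(μ d : ℝ) / (d : ℝ) ^ k| ≤ 1 / (d : ℝ) ^ k := by
  rw [abs_div, abs_of_nonneg (by positivity : (0 : ℝ) ≤ (d : ℝ) ^ k)]
  exact div_le_div_of_nonneg_right (abs_moebius_real_le_one d) (by positivity)

lemma summable_moebius_div_pow {k : ℕ} (hk : 2 ≤ k) :
    Summable fun d : ℕ => (μ d : ℝ) / (d : ℝ) ^ k :=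
  Summable.of_norm_bounded (Real.summable_one_div_nat_pow.2 (by omega))
    fun d => abs_moebius_div_pow_le k d

/-- The term `d = 1` equals `1`, and the others sum in absolute value to at most `π ^ 2 / 6 - 1 <
1`. -/
lemma primitiveDensity_pos {k : ℕ} (hk : 2 ≤ k) : 0 < primitiveDensity k := by
  have h1 : HasSum (fun d : ℕ => if d = 1 then (1 : ℝ) else 0) 1 := hasSum_ite_eq 1 1
  have h2 := hasSum_zeta_two.sub h1
  have h3 := (summable_moebius_div_pow hk).hasSum.sub h1
  have h4 : ∀ d : ℕ, -((1 : ℝ) / (d : ℝ) ^ 2 - if d = 1 then (1 : ℝ) else 0) ≤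
      (μ d : ℝ) / (d : ℝ) ^ k - if d = 1 then (1 : ℝ) else 0 := by
    intro d
    split_ifs with hd
    · subst hd
      simp
    · rw [sub_zero, sub_zero]
      refine le_trans ?_ (neg_le_of_abs_le (abs_moebius_div_pow_le k d))
      rw [neg_le_neg_iff]
      rcases Nat.eq_zero_or_pos d with rfl | hpos
      · simp [show k ≠ 0 by omega]
      · have : (1 : ℝ) ≤ d := by exact_mod_cast hpos
        apply one_div_le_one_div_of_le (by positivity)
        exact pow_le_pow_right₀ this hk
  have h5 := hasSum_le h4 h2.neg h3
  have h6 : Real.pi ^ 2 / 6 < 2 := by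
    nlinarith [Real.pi_lt_d2, Real.pi_pos]
  change 0 < ∑' d : ℕ, (μ d : ℝ) / (d : ℝ) ^ k
  linarith

lemma exists_abs_primitiveCount_sub_le {n : ℕ} (hn : 2 ≤ n) : ∃ C : ℝ, 0 ≤ C ∧
    ∀ I : Set ℝ, I.OrdConnected → ∀ Q : ℝ, 0 < Q →
      |primitiveCount (n + 1) I Q -
        primitiveDensity (n + 1) * rootVolume (n + 1) I * Q ^ (n + 1)| ≤ C * Q ^ n := by
  obtain ⟨C, hC0, hC⟩ := exists_abs_latticeCount_sub_le n
  -- The errors `C * (Q / d) ^ n` are summable over `d` because `n ≥ 2`.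
  have hs : Summable fun d : ℕ => 1 / (d : ℝ) ^ n := Real.summable_one_div_nat_pow.2 (by omega)
  set S : ℝ := ∑' d : ℕ, 1 / (d : ℝ) ^ n
  have hS0 : 0 ≤ S := tsum_nonneg fun d => by positivity
  refine ⟨C * S, mul_nonneg hC0 hS0, fun I hI Q hQ => ?_⟩
  set V := rootVolume (n + 1) I
  have hK := (summable_moebius_div_pow (show 2 ≤ n + 1 by omega)).hasSum.tendsto_sum_nat
  -- Truncate at `D ≥ Q`, where Möbius inversion is exact, bound uniformly in `D`, and let `D → ∞`;
  -- no separate tail estimate is needed.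
  have hlim : Tendsto (fun D : ℕ => |primitiveCount (n + 1) I Q -
      (∑ d ∈ Finset.range D, (μ d : ℝ) / (d : ℝ) ^ (n + 1)) * V * Q ^ (n + 1)|) atTop
      (𝓝 |primitiveCount (n + 1) I Q - primitiveDensity (n + 1) * V * Q ^ (n + 1)|) :=
    (((hK.mul_const V).mul_const (Q ^ (n + 1))).const_sub _).abs
  refine le_of_tendsto hlim ?_
  obtain ⟨D₀, hD₀⟩ := exists_nat_ge Q
  filter_upwards [eventually_ge_atTop (D₀ + 1)] with D hD
  obtain ⟨D, rfl⟩ : ∃ k, D = k + 1 := ⟨D - 1, by omega⟩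
  have hQD : Q ≤ D := hD₀.trans (by exact_mod_cast (by omega : D₀ ≤ D))
  have hrange : ∑ d ∈ Finset.range (D + 1), (μ d : ℝ) / (d : ℝ) ^ (n + 1) =
      ∑ d ∈ Finset.Icc 1 D, (μ d : ℝ) / (d : ℝ) ^ (n + 1) := by
    rw [Finset.range_eq_Ico, Finset.sum_eq_sum_Ico_succ_bot (Nat.succ_pos D)]
    simp only [ArithmeticFunction.map_zero, Int.cast_zero, zero_div, zero_add]
    rfl
  rw [hrange, primitiveCount_eq_sum _ _ hQD, Finset.sum_mul, Finset.sum_mul,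
    ← Finset.sum_sub_distrib]
  refine (Finset.abs_sum_le_sum_abs _ _).trans ?_
  calc _ ≤ ∑ d ∈ Finset.Icc 1 D, C * Q ^ n * (1 / (d : ℝ) ^ n) := by
        refine Finset.sum_le_sum fun d hd => ?_
        have hd0 : (0 : ℝ) < d := Nat.cast_pos.2 (Finset.mem_Icc.1 hd).1
        have h1 := hC I hI (Q / d) (by positivity)
        have h2 : (μ d : ℝ) * latticeCount (n + 1) I (Q / d) -
            (μ d : ℝ) / (d : ℝ) ^ (n + 1) * V * Q ^ (n + 1) =
            (μ d : ℝ) * (latticeCount (n + 1) I (Q / d) - (Q / d) ^ (n + 1) * V) := by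
          rw [div_pow]
          ring
        rw [h2, abs_mul]
        calc _ ≤ 1 * (C * (Q / d) ^ n) :=
              mul_le_mul (abs_moebius_real_le_one d) h1 (abs_nonneg _) zero_le_one
          _ = _ := by rw [div_pow]; ring
    _ = C * Q ^ n * ∑ d ∈ Finset.Icc 1 D, 1 / (d : ℝ) ^ n := by rw [Finset.mul_sum]
    _ ≤ C * Q ^ n * S := by
        gcongr
        exact hs.sum_le_tsum _ fun d _ => by positivity
    _ = _ := by ring

/-! ### Counting reducible polynomials -/

lemma card_filter_coord_eq_le {k : ℕ} (Q : ℝ) (i : Fin (k + 1)) (v : ℤ) :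
    ((intBox (k + 1) Q).filter (fun b => b i = v)).card ≤ (intBox k Q).card := by
  refine Finset.card_le_card_of_injOn (fun b => i.removeNth b) ?_ ?_
  · intro b hb
    have hb' := mem_intBox.1 (Finset.mem_filter.1 hb).1
    exact mem_intBox.2 fun j => hb' _
  · intro b hb c hc hbc
    have h1 := (Finset.mem_filter.1 hb).2
    have h2 := (Finset.mem_filter.1 hc).2
    rw [← Fin.insertNth_self_removeNth i b, ← Fin.insertNth_self_removeNth i c, h1, h2]
    exact congrArg _ hbc

/-- The integer vectors of sup-norm exactly `u`. -/
noncomputable def intSphere (k u : ℕ) : Finset (Fin k → ℤ) :=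
  (intBox k u).filter fun b => ∃ i, (b i).natAbs = u

lemma card_intSphere_le (k : ℕ) {u : ℕ} (hu : 1 ≤ u) :
    ((intSphere (k + 1) u).card : ℝ) ≤ 2 * (k + 1) * (3 * u) ^ k := by
  have hsub : intSphere (k + 1) u ⊆ Finset.univ.biUnion fun i : Fin (k + 1) =>
      (intBox (k + 1) u).filter (fun b => b i = u) ∪
        (intBox (k + 1) u).filter (fun b => b i = -(u : ℤ)) := by
    intro b hb
    obtain ⟨hb, i, hi⟩ := Finset.mem_filter.1 hb
    rw [Finset.mem_biUnion]
    refine ⟨i, Finset.mem_univ i, ?_⟩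
    rw [Finset.mem_union, Finset.mem_filter, Finset.mem_filter]
    rcases Int.natAbs_eq (b i) with h | h
    · exact Or.inl ⟨hb, by rw [h, hi]⟩
    · exact Or.inr ⟨hb, by rw [h, hi]⟩
  have h1 : (intSphere (k + 1) u).card ≤ (k + 1) * (2 * (intBox k u).card) := by
    refine (Finset.card_le_card hsub).trans (Finset.card_biUnion_le.trans ?_)
    refine (Finset.sum_le_sum (g := fun _ => 2 * (intBox k u).card) fun i _ => ?_).trans ?_
    · refine (Finset.card_union_le _ _).trans ?_
      have h1 := card_filter_coord_eq_le (u : ℝ) i (u : ℤ)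
      have h2 := card_filter_coord_eq_le (u : ℝ) i (-(u : ℤ))
      omega
    · simp
  have h2 := card_intBox_le k (Q := (u : ℝ)) (by exact_mod_cast hu)
  calc ((intSphere (k + 1) u).card : ℝ) ≤ (k + 1) * (2 * (intBox k u).card) := by exact_mod_cast h1
    _ ≤ (k + 1) * (2 * (3 * u) ^ k) := by gcongr
    _ = _ := by ring

/-- The hypotheses give `k + 2 ≤ n`, which leaves room for a factor `1 / u ^ 2` and so for a
convergent sum over `u`. -/
lemma pow_mul_div_pow_le {n k : ℕ} (hk : 1 ≤ k) (hkn : 2 * k ≤ n) (hn : 3 ≤ n) {u X : ℝ}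
    (hu : 1 ≤ u) (huX : u ≤ X) : u ^ k * (X / u) ^ (n - k + 1) ≤ X ^ n * (1 / u ^ 2) := by
  have hu0 : 0 < u := by linarith
  have hX0 : 0 < X := by linarith
  rw [div_pow, mul_one_div, ← mul_div_assoc, div_le_div_iff₀ (by positivity) (by positivity)]
  calc u ^ k * X ^ (n - k + 1) * u ^ 2 = X ^ (n - k + 1) * u ^ (k + 2) := by ring
    _ ≤ X ^ (n - k + 1) * u ^ n := by
        gcongr
        omega
    _ = X ^ (n - k + 1) * (u ^ (k - 1) * u ^ (n - k + 1)) := by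
        rw [← pow_add]
        congr 2
        omega
    _ ≤ X ^ (n - k + 1) * (X ^ (k - 1) * u ^ (n - k + 1)) := by gcongr
    _ = X ^ n * u ^ (n - k + 1) := by
        rw [← mul_assoc, ← pow_add]
        congr 2
        omega

/-- Origin of `ell n`: for `n = 2`, `k = 1` the summand is `X ^ 2 / u` and the sum is harmonic; for
`n ≥ 3` it is dominated by `∑ 1 / u ^ 2`. -/
lemma sum_pow_mul_div_pow_le {n k : ℕ} (hn : 2 ≤ n) (hk : 1 ≤ k) (hkn : 2 * k ≤ n) {X : ℝ}
    (hX : 1 ≤ X) : ∑ u ∈ Finset.Icc 1 ⌊X⌋₊, (u : ℝ) ^ k * (X / u) ^ (n - k + 1) ≤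
      2 * (X ^ n * (1 + Real.log X) ^ ell n) := by
  have hmem : ∀ u ∈ Finset.Icc 1 ⌊X⌋₊, (1 : ℝ) ≤ u ∧ (u : ℝ) ≤ X := by
    intro u hu
    rw [Finset.mem_Icc] at hu
    exact ⟨by exact_mod_cast hu.1, (Nat.le_floor_iff (by linarith)).1 hu.2⟩
  have hX0 : (0 : ℝ) < X := by linarith
  by_cases h2 : n = 2
  · subst h2
    obtain rfl : k = 1 := by omega
    have h1 : ∀ u ∈ Finset.Icc 1 ⌊X⌋₊, (u : ℝ) ^ 1 * (X / u) ^ (2 - 1 + 1) = X ^ 2 * (u : ℝ)⁻¹ := by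
      intro u hu
      have : (u : ℝ) ≠ 0 := by linarith [(hmem u hu).1]
      simp only [Nat.add_one_sub_one, Nat.reduceAdd]
      field_simp
    rw [Finset.sum_congr rfl h1, ← Finset.mul_sum]
    have h3 := harmonic_floor_le_one_add_log X hX
    rw [harmonic_eq_sum_Icc] at h3
    push_cast at h3
    have h4 : (0 : ℝ) ≤ 1 + Real.log X := by linarith [Real.log_nonneg hX]
    rw [show ell 2 = 1 from rfl, pow_one]
    calc _ ≤ X ^ 2 * (1 + Real.log X) := by gcongr
      _ ≤ _ := by
        have : 0 ≤ X ^ 2 * (1 + Real.log X) := by positivity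
        linarith
  · have hell : ell n = 0 := if_neg h2
    rw [hell, pow_zero, mul_one]
    calc _ ≤ ∑ u ∈ Finset.Icc 1 ⌊X⌋₊, X ^ n * (1 / (u : ℝ) ^ 2) :=
          Finset.sum_le_sum fun u hu =>
            pow_mul_div_pow_le hk hkn (by omega) (hmem u hu).1 (hmem u hu).2
      _ = X ^ n * ∑ u ∈ Finset.Icc 1 ⌊X⌋₊, 1 / (u : ℝ) ^ 2 := by rw [Finset.mul_sum]
      _ ≤ X ^ n * 2 := by
          gcongr
          refine (hasSum_zeta_two.summable.sum_le_tsum _ fun d _ => by positivity).trans ?_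
          rw [hasSum_zeta_two.tsum_eq]
          nlinarith [Real.pi_lt_d2, Real.pi_pos]
      _ = _ := mul_comm _ _

/-- A form of Gelfond's inequality for the coefficients of a product. -/
lemma abs_coeff_mul_abs_coeff_le {g h : ℤ[X]} {n : ℕ} (hdeg : g.natDegree + h.natDegree = n)
    {Q : ℝ} (hQ : ∀ i, |((g * h).coeff i : ℝ)| ≤ Q) (i j : ℕ) :
    |(g.coeff i : ℝ)| * |(h.coeff j : ℝ)| ≤ 2 ^ n * (n + 1) * Q := by
  set φ : ℤ →+* ℂ := Int.castRingHom ℂ with hφ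
  have hφi : Function.Injective φ := Int.cast_injective
  have hQ0 : 0 ≤ Q := (abs_nonneg _).trans (hQ 0)
  -- Each coefficient is at most a binomial coefficient times the Mahler measure. That measure is
  -- multiplicative and at most the sum of the absolute coefficients.
  have hcoef : ∀ (f : ℤ[X]) (i : ℕ), |(f.coeff i : ℝ)| ≤
      2 ^ f.natDegree * (f.map φ).mahlerMeasure := by
    intro f i
    have h1 := norm_coeff_le_choose_mul_mahlerMeasure i (f.map φ)
    rw [natDegree_map_eq_of_injective hφi, coeff_map] at h1
    have h2 : ‖φ (f.coeff i)‖ = |(f.coeff i : ℝ)| := by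
      simp [hφ]
    rw [h2] at h1
    refine h1.trans (mul_le_mul_of_nonneg_right ?_ (mahlerMeasure_nonneg _))
    exact_mod_cast Nat.choose_le_two_pow _ _
  have hprod : ((g * h).map φ).mahlerMeasure ≤ (n + 1) * Q := by
    refine (mahlerMeasure_le_sum_norm_coeff _).trans ?_
    rw [sum_over_range' _ (fun _ => norm_zero) (n + 1)]
    · refine (Finset.sum_le_sum (g := fun _ => Q) fun i _ => ?_).trans ?_
      · rw [coeff_map]
        have h2 : ‖φ ((g * h).coeff i)‖ = |((g * h).coeff i : ℝ)| := by
          simp [hφ]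
        rw [h2]
        exact hQ i
      · simp
    · rw [natDegree_map_eq_of_injective hφi]
      exact Nat.lt_succ_of_le (natDegree_mul_le.trans hdeg.le)
  rw [Polynomial.map_mul, mahlerMeasure_mul] at hprod
  calc _ ≤ (2 ^ g.natDegree * (g.map φ).mahlerMeasure) *
        (2 ^ h.natDegree * (h.map φ).mahlerMeasure) :=
        mul_le_mul (hcoef g i) (hcoef h j) (abs_nonneg _)
          (mul_nonneg (by positivity) (mahlerMeasure_nonneg _))
    _ = 2 ^ n * ((g.map φ).mahlerMeasure * (h.map φ).mahlerMeasure) := by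
        rw [← hdeg, pow_add]
        ring
    _ ≤ 2 ^ n * ((n + 1) * Q) := by gcongr
    _ = _ := by ring

/-- The vectors of products of two nonconstant polynomials of total degree `n`. -/
noncomputable def reducibleBox (n : ℕ) (Q : ℝ) : Finset (Fin (n + 1) → ℤ) :=
  (intBox (n + 1) Q).filter fun a => ∃ g h : ℤ[X], vecPoly a = g * h ∧
    1 ≤ g.natDegree ∧ 1 ≤ h.natDegree ∧ g.natDegree + h.natDegree = n

/-- Pairs of integer vectors the product of whose sup-norms is at most `X`. -/
noncomputable def factorPairs (n k : ℕ) (X : ℝ) :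
    Finset ((Fin (k + 1) → ℤ) × (Fin (n - k + 1) → ℤ)) :=
  (Finset.Icc 1 ⌊X⌋₊).biUnion fun u => intSphere (k + 1) u ×ˢ intBox (n - k + 1) (X / u)

lemma card_factorPairs_le {n k : ℕ} (hn : 2 ≤ n) (hk : 1 ≤ k) (hkn : 2 * k ≤ n) {X : ℝ}
    (hX : 1 ≤ X) : ((factorPairs n k X).card : ℝ) ≤
      4 * (n + 1) * 3 ^ (n + 1) * (X ^ n * (1 + Real.log X) ^ ell n) := by
  have h1 : ((factorPairs n k X).card : ℝ) ≤ ∑ u ∈ Finset.Icc 1 ⌊X⌋₊,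
      ((intSphere (k + 1) u).card : ℝ) * ((intBox (n - k + 1) (X / u)).card : ℝ) := by
    have := Finset.card_biUnion_le (s := Finset.Icc 1 ⌊X⌋₊)
      (t := fun u => intSphere (k + 1) u ×ˢ intBox (n - k + 1) (X / u))
    simp only [Finset.card_product] at this
    exact_mod_cast this
  refine h1.trans ?_
  have h2 := sum_pow_mul_div_pow_le hn hk hkn hX
  calc _ ≤ ∑ u ∈ Finset.Icc 1 ⌊X⌋₊,
        2 * (n + 1) * 3 ^ (n + 1) * ((u : ℝ) ^ k * (X / u) ^ (n - k + 1)) := by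
        refine Finset.sum_le_sum fun u hu => ?_
        rw [Finset.mem_Icc] at hu
        have hu1 : (1 : ℝ) ≤ u := by exact_mod_cast hu.1
        have huX : (u : ℝ) ≤ X := (Nat.le_floor_iff (by linarith)).1 hu.2
        have h3 := card_intSphere_le k hu.1
        have h4 := card_intBox_le (n - k + 1) (Q := X / u) ((one_le_div (by linarith)).2 huX)
        have hkn' : (k : ℝ) ≤ n := by exact_mod_cast (by omega : k ≤ n)
        have hpow : (3 : ℝ) ^ k * 3 ^ (n - k + 1) = 3 ^ (n + 1) := by
          rw [← pow_add]
          congr 1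
          omega
        calc _ ≤ (2 * (k + 1) * (3 * u) ^ k) * (3 * (X / u)) ^ (n - k + 1) := by gcongr
          _ = 2 * (k + 1) * (3 ^ k * 3 ^ (n - k + 1)) * (u ^ k * (X / u) ^ (n - k + 1)) := by
              rw [mul_pow, mul_pow]
              ring
          _ ≤ _ := by
              rw [hpow]
              have : 0 ≤ X := by linarith
              gcongr
    _ = 2 * (n + 1) * 3 ^ (n + 1) *
        ∑ u ∈ Finset.Icc 1 ⌊X⌋₊, (u : ℝ) ^ k * (X / u) ^ (n - k + 1) := by rw [Finset.mul_sum]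
    _ ≤ 2 * (n + 1) * 3 ^ (n + 1) * (2 * (X ^ n * (1 + Real.log X) ^ ell n)) := by gcongr
    _ = _ := by ring

/-- If `u` is the sup-norm of `g`, Gelfond's inequality bounds every coefficient of `h` by `X / u`.
-/
lemma exists_factorPair {n : ℕ} {Q : ℝ} {a : Fin (n + 1) → ℤ} (ha : a ∈ intBox (n + 1) Q)
    {g h : ℤ[X]} (hgh : vecPoly a = g * h) (hg : 1 ≤ g.natDegree) (hh : 1 ≤ h.natDegree)
    (hdeg : g.natDegree + h.natDegree = n) :
    ∃ p ∈ factorPairs n g.natDegree (2 ^ n * (n + 1) * Q), vecPoly p.1 * vecPoly p.2 = vecPoly a := by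
  have hg0 : g ≠ 0 := by
    rintro rfl
    simp at hg
  have hh0 : h ≠ 0 := by
    rintro rfl
    simp at hh
  have hQ : ∀ i, |((g * h).coeff i : ℝ)| ≤ Q := by
    intro i
    rw [← hgh, vecPoly_coeff]
    split_ifs with hi
    · exact mem_intBox.1 ha _
    · simp only [Int.cast_zero, abs_zero]
      exact (abs_nonneg _).trans (mem_intBox.1 ha 0)
  have hX := abs_coeff_mul_abs_coeff_le hdeg hQ
  set X := 2 ^ n * (n + 1) * Q
  obtain ⟨i, hi, hmax⟩ := Finset.exists_max_image (Finset.range (g.natDegree + 1))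
    (fun i => (g.coeff i).natAbs) ⟨0, by simp⟩
  set u := (g.coeff i).natAbs with hu
  have hcast : ∀ z : ℤ, |(z : ℝ)| = z.natAbs := fun z => by
    rw [← Int.cast_abs, Int.abs_eq_natAbs]
    simp
  have hu1 : 1 ≤ u := by
    refine le_trans ?_ (hmax g.natDegree (by simp))
    exact Int.natAbs_pos.2 (leadingCoeff_ne_zero.2 hg0)
  have hu0 : (0 : ℝ) < u := by exact_mod_cast hu1
  have huX : (u : ℝ) ≤ X := by
    have h1 := hX i h.natDegree
    have h2 : (1 : ℝ) ≤ |(h.coeff h.natDegree : ℝ)| := by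
      rw [hcast]
      exact_mod_cast Int.natAbs_pos.2 (leadingCoeff_ne_zero.2 hh0)
    rw [hcast (g.coeff i), ← hu] at h1
    nlinarith
  refine ⟨(fun j => g.coeff j, fun j => h.coeff j), ?_, ?_⟩
  · rw [factorPairs, Finset.mem_biUnion]
    refine ⟨u, Finset.mem_Icc.2 ⟨hu1, Nat.le_floor huX⟩, ?_⟩
    rw [Finset.mem_product, intSphere, Finset.mem_filter, mem_intBox, mem_intBox]
    refine ⟨⟨fun j => ?_, ⟨i, Finset.mem_range.1 hi⟩, rfl⟩, fun j => ?_⟩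
    · rw [hcast]
      exact_mod_cast hmax j (Finset.mem_range.2 j.2)
    · rw [le_div_iff₀ hu0, mul_comm, ← hcast]
      exact hX i j
  · rw [hgh, vecPoly_coeff_self (Nat.lt_succ_self _), vecPoly_coeff_self (by omega)]

lemma exists_card_reducibleBox_le {n : ℕ} (hn : 2 ≤ n) : ∃ C : ℝ, 0 ≤ C ∧ ∀ Q : ℝ, 1 ≤ Q →
    ((reducibleBox n Q).card : ℝ) ≤ C * (Q ^ n * (1 + Real.log Q) ^ ell n) := by
  set c : ℝ := 2 ^ n * (n + 1) with hc
  have hc1 : 1 ≤ c := by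
    have h1 : (1 : ℝ) ≤ 2 ^ n := one_le_pow₀ (by norm_num)
    have h2 : (0 : ℝ) ≤ n := Nat.cast_nonneg n
    nlinarith
  have hlogc := Real.log_nonneg hc1
  set A : ℝ := 4 * (n + 1) * 3 ^ (n + 1)
  refine ⟨n * A * (c ^ n * (1 + Real.log c) ^ ell n), by positivity, fun Q hQ => ?_⟩
  have hX : 1 ≤ c * Q := by nlinarith
  have hlogQ := Real.log_nonneg hQ
  set J := (Finset.Icc 1 n).filter fun k => 2 * k ≤ n
  have hsub : reducibleBox n Q ⊆ J.biUnion fun k => (factorPairs n k (c * Q)).image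
      fun p i => (vecPoly p.1 * vecPoly p.2).coeff (i : Fin (n + 1)) := by
    intro a ha
    obtain ⟨ha, g, h, hgh, hg, hh, hdeg⟩ := Finset.mem_filter.1 ha
    -- Taking `g` to be the factor of smaller degree `k` provides the condition `2 * k ≤ n` under
    -- which pairs are counted.
    wlog hle : g.natDegree ≤ h.natDegree generalizing g h
    · exact this h g (by rw [hgh, mul_comm]) hh hg (by omega) (by omega)
    obtain ⟨p, hp, hpa⟩ := exists_factorPair ha hgh hg hh hdeg
    rw [Finset.mem_biUnion]
    refine ⟨g.natDegree, Finset.mem_filter.2 ⟨Finset.mem_Icc.2 ⟨hg, by omega⟩, by omega⟩, ?_⟩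
    refine Finset.mem_image.2 ⟨p, hp, ?_⟩
    funext i
    rw [hpa, vecPoly_coeff_fin]
  have h1 : ((reducibleBox n Q).card : ℝ) ≤ ∑ k ∈ J, ((factorPairs n k (c * Q)).card : ℝ) := by
    have := (Finset.card_le_card hsub).trans (Finset.card_biUnion_le.trans
      (Finset.sum_le_sum fun k _ => Finset.card_image_le))
    exact_mod_cast this
  have hJ : (J.card : ℝ) ≤ n := by
    have : J.card ≤ n := (Finset.card_filter_le _ _).trans (by simp)
    exact_mod_cast this
  have hlogX : 1 + Real.log (c * Q) ≤ (1 + Real.log c) * (1 + Real.log Q) := by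
    rw [Real.log_mul (by linarith) (by linarith)]
    nlinarith
  have hlogX0 := Real.log_nonneg hX
  calc ((reducibleBox n Q).card : ℝ) ≤ ∑ k ∈ J, ((factorPairs n k (c * Q)).card : ℝ) := h1
    _ ≤ ∑ k ∈ J, A * ((c * Q) ^ n * (1 + Real.log (c * Q)) ^ ell n) := by
        refine Finset.sum_le_sum fun k hk => ?_
        obtain ⟨hk, hkn⟩ := Finset.mem_filter.1 hk
        exact card_factorPairs_le hn (Finset.mem_Icc.1 hk).1 hkn hX
    _ = J.card * (A * ((c * Q) ^ n * (1 + Real.log (c * Q)) ^ ell n)) := by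
        rw [Finset.sum_const, nsmul_eq_mul]
    _ ≤ n * (A * ((c * Q) ^ n * ((1 + Real.log c) * (1 + Real.log Q)) ^ ell n)) := by gcongr
    _ = _ := by
        rw [mul_pow c, mul_pow (1 + Real.log c)]
        ring

/-! ### Minimal polynomials over the integers -/

/-- Take an annihilating polynomial of least degree and divide by its content. -/
lemma exists_isIntMinpoly {x : ℝ} (hx : IsAlgebraic ℤ x) : ∃ p, IsIntMinpoly p x := by
  have hex : ∃ d : ℕ, ∃ q : ℤ[X], q ≠ 0 ∧ aeval x q = 0 ∧ q.natDegree = d := by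
    obtain ⟨q, hq, hq0⟩ := hx
    exact ⟨_, q, hq, hq0, rfl⟩
  obtain ⟨q, hq, hq0, hqd⟩ := Nat.find_spec hex
  refine ⟨q.primPart, q.primPart_ne_zero, ?_, fun r hr hr0 => ?_, q.isPrimitive_primPart⟩
  · have h1 : aeval x (C q.content * q.primPart) = 0 := by rwa [← q.eq_C_content_mul_primPart]
    rw [map_mul, aeval_C, mul_eq_zero] at h1
    refine h1.resolve_left ?_
    simpa [content_eq_zero_iff] using hq
  · rw [natDegree_primPart, hqd]
    exact Nat.find_min' hex ⟨r, hr, hr0, rfl⟩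

/-- By Gauss's lemma divisibility may be tested over `ℚ`. A nonzero remainder there, after clearing
denominators, would be an integer annihilator of smaller degree. -/
lemma IsIntMinpoly.dvd {x : ℝ} {q p : ℤ[X]} (hq : IsIntMinpoly q x) (hp : aeval x p = 0) :
    q ∣ p := by
  rw [IsPrimitive.Int.dvd_iff_map_cast_dvd_map_cast _ _ hq.primitive]
  set q' : ℚ[X] := q.map (Int.castRingHom ℚ) with hq'
  set p' : ℚ[X] := p.map (Int.castRingHom ℚ) with hp'
  have hinj : Function.Injective (Int.castRingHom ℚ) := Int.cast_injective
  have hq'0 : q' ≠ 0 := (Polynomial.map_ne_zero_iff hinj).2 hq.ne_zero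
  have haev : ∀ f : ℤ[X], aeval x (f.map (Int.castRingHom ℚ)) = aeval x f := fun f =>
    aeval_map_algebraMap ℚ x f
  have hr0 : aeval x (p' % q') = 0 := by
    have h := EuclideanDomain.div_add_mod p' q'
    have h1 := congrArg (aeval x) h
    rw [map_add, map_mul, hq', hp', haev, haev, hq.root, hp, zero_mul, zero_add] at h1
    exact h1
  by_contra hndvd
  have hr : p' % q' ≠ 0 := fun h => hndvd ((EuclideanDomain.mod_eq_zero).1 h)
  set s := IsLocalization.integerNormalization (nonZeroDivisors ℤ) (p' % q') with hs
  have hs0 : s ≠ 0 := fun h => hr (IsFractionRing.integerNormalization_eq_zero_iff.1 h)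
  have hsr : aeval x s = 0 := IsLocalization.integerNormalization_aeval_eq_zero _ _ hr0
  have h1 := hq.minimal s hs0 hsr
  have h2 : s.natDegree ≤ (p' % q').natDegree :=
    natDegree_le_natDegree (Finset.sup_mono (IsLocalization.integerNormalization_support _ _))
  have h3 : (p' % q').degree < q'.degree := EuclideanDomain.mod_lt _ hq'0
  have h4 : (p' % q').natDegree < q'.natDegree := natDegree_lt_natDegree hr h3
  have h5 : q'.natDegree = q.natDegree := natDegree_map_eq_of_injective hinj q
  omega

lemma IsIntMinpoly.neg {x : ℝ} {p : ℤ[X]} (hp : IsIntMinpoly p x) : IsIntMinpoly (-p) x where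
  ne_zero := neg_ne_zero.2 hp.ne_zero
  root := by rw [map_neg, hp.root, neg_zero]
  minimal q hq hq0 := by rw [natDegree_neg]; exact hp.minimal q hq hq0
  primitive r hr := hp.primitive r (by rwa [dvd_neg] at hr)

lemma IsIntMinpoly.eq_or_eq_neg {x : ℝ} {p q : ℤ[X]} (hp : IsIntMinpoly p x)
    (hq : IsIntMinpoly q x) : p = q ∨ p = -q := by
  have hass : Associated p q := associated_of_dvd_dvd (hp.dvd hq.root) (hq.dvd hp.root)
  obtain ⟨u, hu⟩ := hass.symm
  obtain ⟨r, hr, hru⟩ := Polynomial.isUnit_iff.1 u.isUnit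
  rcases Int.isUnit_iff.1 hr with rfl | rfl
  · left
    rw [← hu, ← hru]
    simp
  · right
    rw [← hu, ← hru]
    simp

lemma intMinpoly_spec {x : ℝ} (hx : IsAlgebraic ℤ x) : IsIntMinpoly (intMinpoly x) x := by
  rw [intMinpoly, dif_pos (exists_isIntMinpoly hx)]
  exact (exists_isIntMinpoly hx).choose_spec

lemma IsIntMinpoly.isAlgebraic {x : ℝ} {p : ℤ[X]} (hp : IsIntMinpoly p x) : IsAlgebraic ℤ x :=
  ⟨p, hp.ne_zero, hp.root⟩

lemma polyHeight_neg (p : ℤ[X]) : polyHeight (-p) = polyHeight p := by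
  simp [polyHeight]

lemma polyHeight_le_iff {p : ℤ[X]} {Q : ℝ} (hQ : 0 ≤ Q) :
    (polyHeight p : ℝ) ≤ Q ↔ ∀ i, |(p.coeff i : ℝ)| ≤ Q := by
  have hcast : ∀ z : ℤ, |(z : ℝ)| = z.natAbs := fun z => by
    rw [← Int.cast_abs, Int.abs_eq_natAbs]
    simp
  rw [← Nat.le_floor_iff hQ, polyHeight, Finset.sup_le_iff]
  constructor
  · intro h i
    by_cases hi : i ∈ p.support
    · rw [hcast]
      exact (Nat.le_floor_iff hQ).1 (h i hi)
    · rw [notMem_support_iff.1 hi]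
      simpa using hQ
  · intro h i _
    refine Nat.le_floor ?_
    rw [← hcast]
    exact h i

lemma IsIntMinpoly.degree_eq {x : ℝ} {p : ℤ[X]} (hp : IsIntMinpoly p x) :
    degree x = p.natDegree := by
  rcases (intMinpoly_spec hp.isAlgebraic).eq_or_eq_neg hp with h | h <;> rw [degree, h]
  exact natDegree_neg p

lemma IsIntMinpoly.height_eq {x : ℝ} {p : ℤ[X]} (hp : IsIntMinpoly p x) :
    height x = polyHeight p := by
  rcases (intMinpoly_spec hp.isAlgebraic).eq_or_eq_neg hp with h | h <;> rw [height, h]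
  exact polyHeight_neg p

lemma polyHeight_vecPoly_le_iff {m : ℕ} {a : Fin m → ℤ} {Q : ℝ} (hQ : 0 ≤ Q) :
    (polyHeight (vecPoly a) : ℝ) ≤ Q ↔ a ∈ intBox m Q := by
  rw [polyHeight_le_iff hQ, mem_intBox]
  constructor
  · intro h i
    rw [← vecPoly_coeff_fin a i]
    exact h i
  · intro h i
    rw [vecPoly_coeff]
    split_ifs
    · exact h _
    · simpa using hQ

lemma vecPoly_cast {m : ℕ} (a : Fin m → ℤ) :
    vecPoly (fun i => (a i : ℝ)) = (vecPoly a).map (Int.castRingHom ℝ) :=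
  (vecPoly_map (Int.castRingHom ℝ) a).symm

lemma eval_vecPoly_cast {m : ℕ} (a : Fin m → ℤ) (x : ℝ) :
    (vecPoly (fun i => (a i : ℝ))).eval x = aeval x (vecPoly a) := by
  rw [vecPoly_cast, eval_map, aeval_def]
  rfl

/-! ### Pairs of a primitive polynomial and a root -/

/-- The pairs of a primitive coefficient vector in the box and a root in `I`. -/
noncomputable def rootPairs (n : ℕ) (Q : ℝ) (I : Set ℝ) : Finset ((Fin (n + 1) → ℤ) × ℝ) :=
  ((intBox (n + 1) Q).filter fun a => (vecPoly a).IsPrimitive).biUnion fun a =>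
    (((vecPoly fun i => (a i : ℝ)).roots.toFinset.filter (· ∈ I)).image fun x => (a, x))

lemma mem_rootPairs {n : ℕ} {Q : ℝ} {I : Set ℝ} {p : (Fin (n + 1) → ℤ) × ℝ} :
    p ∈ rootPairs n Q I ↔ p.1 ∈ intBox (n + 1) Q ∧ (vecPoly p.1).IsPrimitive ∧ p.2 ∈ I ∧
      aeval p.2 (vecPoly p.1) = 0 := by
  obtain ⟨a, x⟩ := p
  simp only [rootPairs, Finset.mem_biUnion, Finset.mem_filter, Finset.mem_image,
    Multiset.mem_toFinset, Prod.mk.injEq]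
  constructor
  · rintro ⟨b, ⟨hb, hbp⟩, y, ⟨hy, hyI⟩, rfl, rfl⟩
    refine ⟨hb, hbp, hyI, ?_⟩
    rw [← eval_vecPoly_cast]
    exact (mem_roots'.1 hy).2
  · rintro ⟨ha, hap, hx, h0⟩
    refine ⟨a, ⟨ha, hap⟩, x, ⟨?_, hx⟩, rfl, rfl⟩
    rw [mem_roots', vecPoly_cast]
    refine ⟨(Polynomial.map_ne_zero_iff Int.cast_injective).2 hap.ne_zero, ?_⟩
    rw [IsRoot.def, ← vecPoly_cast, eval_vecPoly_cast, h0]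

lemma card_rootPairs (n : ℕ) (Q : ℝ) (I : Set ℝ) :
    ((rootPairs n Q I).card : ℝ) = primitiveCount (n + 1) I Q := by
  rw [rootPairs, Finset.card_biUnion, primitiveCount, Nat.cast_sum]
  · refine Finset.sum_congr rfl fun a _ => ?_
    rw [Finset.card_image_of_injective _ (Prod.mk_right_injective a)]
    rfl
  · intro a _ b _ hab
    rw [Function.onFun, Finset.disjoint_left]
    intro p hp hp'
    obtain ⟨x, -, rfl⟩ := Finset.mem_image.1 hp
    obtain ⟨y, -, hy⟩ := Finset.mem_image.1 hp'
    exact hab (congrArg Prod.fst hy).symm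

lemma coe_image_rootPairs {n : ℕ} {Q : ℝ} (hQ : 0 ≤ Q) (I : Set ℝ) :
    ((((rootPairs n Q I).filter fun p => IsIntMinpoly (vecPoly p.1) p.2 ∧
      (vecPoly p.1).natDegree = n).image Prod.snd : Finset ℝ) : Set ℝ) = algNumbersLE n Q ∩ I := by
  ext x
  simp only [Finset.coe_image, Set.mem_image, Finset.mem_coe]
  constructor
  · rintro ⟨p, hp, rfl⟩
    obtain ⟨hp, hmin, hdeg⟩ := Finset.mem_filter.1 hp
    obtain ⟨hbox, -, hI, -⟩ := mem_rootPairs.1 hp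
    refine ⟨⟨⟨hmin.isAlgebraic, hmin.degree_eq.trans hdeg⟩, ?_⟩, hI⟩
    rw [hmin.height_eq]
    exact (polyHeight_vecPoly_le_iff hQ).2 hbox
  · rintro ⟨⟨⟨halg, hdeg⟩, hht⟩, hI⟩
    have hmin := intMinpoly_spec halg
    have hd : (intMinpoly x).natDegree = n := hdeg
    have hv : vecPoly (fun i : Fin (n + 1) => (intMinpoly x).coeff i) = intMinpoly x :=
      vecPoly_coeff_self (by omega)
    refine ⟨(fun i => (intMinpoly x).coeff i, x), ?_, rfl⟩
    rw [Finset.mem_filter, mem_rootPairs, ← polyHeight_vecPoly_le_iff hQ]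
    dsimp only
    rw [hv]
    exact ⟨⟨hht, hmin.primitive, hI, hmin.root⟩, hmin, hd⟩

lemma finite_algNumbersLE (n : ℕ) (Q : ℝ) : (algNumbersLE n Q).Finite := by
  rcases le_or_gt 0 Q with hQ | hQ
  · rw [← Set.inter_univ (algNumbersLE n Q), ← coe_image_rootPairs hQ]
    exact Finset.finite_toSet _
  · convert Set.finite_empty
    refine Set.eq_empty_iff_forall_notMem.2 fun x hx => ?_
    have : (0 : ℝ) ≤ height x := Nat.cast_nonneg _
    linarith [hx.2]

/-- Each algebraic number of degree `n` corresponds to exactly two pairs. -/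
lemma card_filter_isIntMinpoly {n : ℕ} {Q : ℝ} (hQ : 0 ≤ Q) (I : Set ℝ) :
    ((rootPairs n Q I).filter fun p => IsIntMinpoly (vecPoly p.1) p.2 ∧
      (vecPoly p.1).natDegree = n).card = 2 * countingFunction n Q I := by
  set G := (rootPairs n Q I).filter fun p => IsIntMinpoly (vecPoly p.1) p.2 ∧
      (vecPoly p.1).natDegree = n with hG
  have himg := coe_image_rootPairs (n := n) hQ I
  rw [← hG] at himg
  rw [countingFunction, ← himg, Set.ncard_coe_finset,
    Finset.card_eq_sum_card_image Prod.snd G, mul_comm, ← smul_eq_mul, ← Finset.sum_const]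
  refine Finset.sum_congr rfl fun x hx => ?_
  obtain ⟨⟨a, y⟩, hp, rfl⟩ := Finset.mem_image.1 hx
  obtain ⟨hp', hmin, hdeg⟩ := Finset.mem_filter.1 hp
  obtain ⟨hbox, hprim, hI, h0⟩ := mem_rootPairs.1 hp'
  dsimp only at *
  have hvneg : vecPoly (-a) = -vecPoly a := by
    have := vecPoly_smul (-1 : ℤ) a
    simpa using this
  have hane : a ≠ -a := by
    intro h
    apply hmin.ne_zero
    rw [vecPoly_eq_zero_iff]
    funext i
    have := congrFun h i
    simp only [Pi.neg_apply] at this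
    simp only [Pi.zero_apply]
    omega
  have hfib : G.filter (fun p => p.2 = y) = {(a, y), (-a, y)} := by
    ext ⟨b, z⟩
    rw [Finset.mem_filter, Finset.mem_insert, Finset.mem_singleton]
    constructor
    · rintro ⟨hb, rfl⟩
      obtain ⟨-, hbmin, -⟩ := Finset.mem_filter.1 hb
      rcases hbmin.eq_or_eq_neg hmin with h | h
      · exact Or.inl (Prod.ext (vecPoly_injective h) rfl)
      · rw [← hvneg] at h
        exact Or.inr (Prod.ext (vecPoly_injective h) rfl)
    · rintro (h | h)
      · rw [h]
        exact ⟨hp, rfl⟩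
      · rw [h]
        refine ⟨Finset.mem_filter.2 ⟨mem_rootPairs.2 ⟨?_, ?_, hI, ?_⟩, ?_, ?_⟩, rfl⟩
        · rw [mem_intBox] at hbox ⊢
          intro i
          simpa using hbox i
        · dsimp only
          rw [hvneg]
          exact hmin.neg.primitive
        · dsimp only
          rw [hvneg]
          exact hmin.neg.root
        · dsimp only
          rw [hvneg]
          exact hmin.neg
        · dsimp only
          rw [hvneg, natDegree_neg, hdeg]
  rw [hfib, Finset.card_pair]
  intro h
  exact hane (congrArg Prod.fst h)

/-- In a bad pair either the top coefficient vanishes, or the minimal polynomial of the root is a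
proper factor and the polynomial is reducible. Each such vector has at most `n + 1` roots. -/
lemma card_filter_not_isIntMinpoly_le {n : ℕ} (Q : ℝ) (I : Set ℝ) :
    ((rootPairs n Q I).filter fun p => ¬(IsIntMinpoly (vecPoly p.1) p.2 ∧
      (vecPoly p.1).natDegree = n)).card ≤
        (n + 1) * ((intBox n Q).card + (reducibleBox n Q).card) := by
  set A := (intBox (n + 1) Q).filter (fun a => a (Fin.last n) = 0) ∪ reducibleBox n Q with hA
  have hAcard : A.card ≤ (intBox n Q).card + (reducibleBox n Q).card :=
    (Finset.card_union_le _ _).trans (Nat.add_le_add_right (card_filter_coord_eq_le Q _ 0) _)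
  have hsub : ((rootPairs n Q I).filter fun p => ¬(IsIntMinpoly (vecPoly p.1) p.2 ∧
      (vecPoly p.1).natDegree = n)) ⊆ A.biUnion fun a =>
        (((vecPoly fun i => (a i : ℝ)).roots.toFinset.filter (· ∈ I)).image fun x => (a, x)) := by
    intro p hp
    obtain ⟨hp, hbad⟩ := Finset.mem_filter.1 hp
    have hroot := hp
    obtain ⟨hbox, hprim, hI, h0⟩ := mem_rootPairs.1 hp
    rw [rootPairs, Finset.mem_biUnion] at hroot
    obtain ⟨a, ha, hpa⟩ := hroot
    obtain ⟨x, -, hax⟩ := Finset.mem_image.1 hpa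
    obtain rfl : a = p.1 := by rw [← hax]
    refine Finset.mem_biUnion.2 ⟨p.1, ?_, hpa⟩
    rw [hA, Finset.mem_union]
    have hne := hprim.ne_zero
    have hane : p.1 ≠ 0 := fun h => hne ((vecPoly_eq_zero_iff _).2 h)
    have hle : (vecPoly p.1).natDegree < n + 1 := vecPoly_natDegree_lt _ hane
    by_cases hdeg : (vecPoly p.1).natDegree = n
    · right
      have hnmin : ¬IsIntMinpoly (vecPoly p.1) p.2 := fun h => hbad ⟨h, hdeg⟩
      obtain ⟨q, hq⟩ := exists_isIntMinpoly (x := p.2) ⟨_, hne, h0⟩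
      obtain ⟨h, hqh⟩ := hq.dvd h0
      have hh0 : h ≠ 0 := by
        rintro rfl
        rw [mul_zero] at hqh
        exact hne hqh
      have hsum : q.natDegree + h.natDegree = n := by
        rw [← hdeg, hqh, natDegree_mul hq.ne_zero hh0]
      refine Finset.mem_filter.2 ⟨hbox, q, h, hqh, ?_, ?_, hsum⟩
      · by_contra hlt
        have hq0 : q.natDegree = 0 := by omega
        have hroot := hq.root
        rw [eq_C_of_natDegree_eq_zero hq0, aeval_C] at hroot
        apply hq.ne_zero
        rw [eq_C_of_natDegree_eq_zero hq0]
        simpa using hroot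
      -- A constant cofactor would give the polynomial the least possible degree, making it minimal
      -- itself.
      · by_contra hlt
        refine hnmin ⟨hne, h0, fun r hr hr0 => ?_, hprim⟩
        have := hq.minimal r hr hr0
        omega
    · left
      refine Finset.mem_filter.2 ⟨hbox, ?_⟩
      rw [← vecPoly_coeff_fin p.1 (Fin.last n)]
      apply coeff_eq_zero_of_natDegree_lt
      simp only [Fin.val_last]
      omega
  refine (Finset.card_le_card hsub).trans (Finset.card_biUnion_le.trans ?_)
  refine (Finset.sum_le_sum (g := fun _ => n + 1) fun a _ => ?_).trans ?_
  · exact Finset.card_image_le.trans (rootCount_vecPoly_le I _)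
  · rw [Finset.sum_const, smul_eq_mul, mul_comm]
    exact Nat.mul_le_mul_left _ hAcard

/-- The asymptotic formula for the counting function, uniform in the interval. -/
lemma exists_abs_countingFunction_sub_le {n : ℕ} (hn : 2 ≤ n) : ∃ C : ℝ, 0 ≤ C ∧
    ∀ I : Set ℝ, I.OrdConnected → ∀ Q : ℝ, 1 ≤ Q →
      |(countingFunction n Q I : ℝ) -
        primitiveDensity (n + 1) / 2 * rootVolume (n + 1) I * Q ^ (n + 1)| ≤
          C * (Q ^ n * (1 + Real.log Q) ^ ell n) := by
  obtain ⟨C₁, hC₁, h₁⟩ := exists_abs_primitiveCount_sub_le hn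
  obtain ⟨C₂, hC₂, h₂⟩ := exists_card_reducibleBox_le hn
  refine ⟨C₁ + (n + 1) * (3 ^ n + C₂), by positivity, fun I hI Q hQ => ?_⟩
  have hsplit := Finset.card_filter_add_card_filter_not (s := rootPairs n Q I)
    (fun p => IsIntMinpoly (vecPoly p.1) p.2 ∧ (vecPoly p.1).natDegree = n)
  rw [card_filter_isIntMinpoly (by linarith)] at hsplit
  have hbad := card_filter_not_isIntMinpoly_le (n := n) Q I
  set b := ((rootPairs n Q I).filter fun p => ¬(IsIntMinpoly (vecPoly p.1) p.2 ∧
      (vecPoly p.1).natDegree = n)).card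
  -- Good pairs count each number twice, for the two signs; the `b` bad pairs go into the error.
  have hsplit' : 2 * (countingFunction n Q I : ℝ) + b = primitiveCount (n + 1) I Q := by
    rw [← card_rootPairs]
    exact_mod_cast hsplit
  have hbad' : (b : ℝ) ≤ (n + 1) * ((intBox n Q).card + (reducibleBox n Q).card) := by
    exact_mod_cast hbad
  have hlog : 1 ≤ (1 + Real.log Q) ^ ell n :=
    one_le_pow₀ (by linarith [Real.log_nonneg hQ])
  set E := Q ^ n * (1 + Real.log Q) ^ ell n with hE
  have hQE : Q ^ n ≤ E := le_mul_of_one_le_right (by positivity) hlog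
  have hb : (b : ℝ) ≤ (n + 1) * (3 ^ n + C₂) * E := by
    have h3 := card_intBox_le n hQ
    rw [mul_pow] at h3
    have h4 := h₂ Q hQ
    calc (b : ℝ) ≤ (n + 1) * ((intBox n Q).card + (reducibleBox n Q).card) := hbad'
      _ ≤ (n + 1) * (3 ^ n * E + C₂ * E) := by
          gcongr
          exact h3.trans (by gcongr)
      _ = _ := by ring
  have hp := abs_le.1 (h₁ I hI Q (by linarith))
  have hCE : C₁ * Q ^ n ≤ C₁ * E := by gcongr
  have hb0 : (0 : ℝ) ≤ b := Nat.cast_nonneg b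
  have hCE0 : 0 ≤ C₁ * E := by positivity
  have hbE0 := hb0.trans hb
  rw [abs_le]
  constructor <;> nlinarith [hp.1, hp.2]

/-! ### The distribution function -/

lemma ell_le_one (n : ℕ) : ell n ≤ 1 := by
  rw [ell]
  split_ifs <;> simp

/-- The error term `Q ^ n (1 + log Q) ^ ℓ(n)`. -/
noncomputable def errorTerm (n : ℕ) (Q : ℝ) : ℝ := Q ^ n * (1 + Real.log Q) ^ ell n

lemma errorTerm_nonneg (n : ℕ) {Q : ℝ} (hQ : 1 ≤ Q) : 0 ≤ errorTerm n Q := by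
  have := Real.log_nonneg hQ
  rw [errorTerm]
  positivity

lemma pow_le_errorTerm (n : ℕ) {Q : ℝ} (hQ : 1 ≤ Q) : Q ^ n ≤ errorTerm n Q :=
  le_mul_of_one_le_right (by positivity) (one_le_pow₀ (by linarith [Real.log_nonneg hQ]))

lemma errorTerm_mono (n : ℕ) {Q R : ℝ} (hQ : 1 ≤ Q) (hQR : Q ≤ R) :
    errorTerm n Q ≤ errorTerm n R := by
  have h0 := Real.log_nonneg hQ
  have h1 := Real.log_le_log (by linarith) hQR
  have h2 : 0 ≤ R := by linarith
  rw [errorTerm, errorTerm]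
  gcongr

lemma tendsto_errorTerm_div (n : ℕ) :
    Tendsto (fun Q => errorTerm n Q / Q ^ (n + 1)) atTop (𝓝 0) := by
  have h1 : Tendsto (fun Q : ℝ => (1 + Real.log Q) / Q) atTop (𝓝 0) := by
    have h2 : Tendsto (fun Q : ℝ => Q⁻¹ + Real.log Q / Q) atTop (𝓝 (0 + 0)) :=
      tendsto_inv_atTop_zero.add Real.isLittleO_log_id_atTop.tendsto_div_nhds_zero
    rw [add_zero] at h2
    refine h2.congr fun Q => ?_
    rw [add_div, one_div]
  refine squeeze_zero' ?_ ?_ h1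
  · filter_upwards [eventually_ge_atTop 1] with Q hQ
    exact div_nonneg (errorTerm_nonneg n hQ) (by positivity)
  · filter_upwards [eventually_ge_atTop 1] with Q hQ
    have hlog := Real.log_nonneg hQ
    have hQ0 : 0 < Q := by linarith
    have h3 : (1 + Real.log Q) ^ ell n ≤ 1 + Real.log Q := by
      calc _ ≤ (1 + Real.log Q) ^ 1 := pow_le_pow_right₀ (by linarith) (ell_le_one n)
        _ = _ := pow_one _
    rw [errorTerm, pow_succ, mul_div_mul_left _ _ (by positivity)]
    gcongr

lemma tendsto_countingFunction_div {n : ℕ} (hn : 2 ≤ n) {I : Set ℝ} (hI : I.OrdConnected) :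
    Tendsto (fun Q : ℝ => (countingFunction n Q I : ℝ) / Q ^ (n + 1)) atTop
      (𝓝 (primitiveDensity (n + 1) / 2 * rootVolume (n + 1) I)) := by
  obtain ⟨C, hC0, hC⟩ := exists_abs_countingFunction_sub_le hn
  rw [tendsto_iff_norm_sub_tendsto_zero]
  have h := (tendsto_errorTerm_div n).const_mul C
  rw [mul_zero] at h
  refine squeeze_zero' (Filter.Eventually.of_forall fun _ => norm_nonneg _) ?_ h
  filter_upwards [eventually_ge_atTop 1] with Q hQ
  have hQ0 : 0 < Q ^ (n + 1) := by positivity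
  have h1 := hC I hI Q hQ
  rw [Real.norm_eq_abs, div_sub' hQ0.ne', abs_div, abs_of_pos hQ0, ← mul_div_assoc]
  rw [mul_comm (Q ^ (n + 1))]
  gcongr
  exact h1

/-- The arithmetic constant and the power of `Q` cancel in the quotient, leaving a ratio of volumes.
-/
lemma tendsto_proportion {n : ℕ} (hn : 2 ≤ n) (x : ℝ) : Tendsto (proportion n x) atTop
    (𝓝 (rootVolume (n + 1) (Set.Iic x) / rootVolume (n + 1) Set.univ)) := by
  have hK := primitiveDensity_pos (k := n + 1) (by omega)
  have hV := rootVolume_univ_pos (n := n) (by omega)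
  have h := (tendsto_countingFunction_div hn (Set.ordConnected_Iic (a := x))).div
    (tendsto_countingFunction_div hn Set.ordConnected_univ) (by positivity)
  rw [mul_div_mul_left _ _ (by positivity)] at h
  refine h.congr' ?_
  filter_upwards [eventually_ge_atTop 1] with Q hQ
  rw [Pi.div_apply, div_div_div_cancel_right₀ (by positivity)]
  rfl

lemma distributionFunction_eq {n : ℕ} (hn : 2 ≤ n) (x : ℝ) : distributionFunction n x =
    rootVolume (n + 1) (Set.Iic x) / rootVolume (n + 1) Set.univ :=
  (tendsto_proportion hn x).limUnder_eq

lemma hasDerivAt_distributionFunction {n : ℕ} (hn : 2 ≤ n) (x : ℝ) :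
    HasDerivAt (distributionFunction n) (rootDensity n x / rootVolume (n + 1) Set.univ) x := by
  rw [show distributionFunction n = fun x => rootVolume (n + 1) (Set.Iic x) /
    rootVolume (n + 1) Set.univ from funext (distributionFunction_eq hn)]
  exact (hasDerivAt_rootVolume_Iic n x).div_const _

lemma distributionDensity_eq {n : ℕ} (hn : 2 ≤ n) :
    distributionDensity n = fun x => rootDensity n x / rootVolume (n + 1) Set.univ :=
  funext fun x => (hasDerivAt_distributionFunction hn x).deriv

lemma setIntegral_distributionDensity {n : ℕ} (hn : 2 ≤ n) {I : Set ℝ} (hI : I.OrdConnected) :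
    ∫ x in I, distributionDensity n x =
      rootVolume (n + 1) I / rootVolume (n + 1) Set.univ := by
  rw [distributionDensity_eq hn, integral_div, setIntegral_rootDensity hI]

lemma rootVolume_le_univ (n : ℕ) {I : Set ℝ} (hI : I.OrdConnected) :
    rootVolume (n + 1) I ≤ rootVolume (n + 1) Set.univ := by
  rw [← setIntegral_rootDensity hI, ← setIntegral_rootDensity Set.ordConnected_univ,
    setIntegral_univ]
  exact setIntegral_le_integral (integrable_rootDensity n)
    (Filter.Eventually.of_forall (rootDensity_nonneg n))

/-! ### Sequences ordered by height -/

lemma one_le_height {x : ℝ} (hx : IsAlgebraic ℤ x) : 1 ≤ height x := by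
  have h := (intMinpoly_spec hx).ne_zero
  rw [height, polyHeight]
  refine le_trans ?_ (Finset.le_sup (f := fun i => ((intMinpoly x).coeff i).natAbs)
    (natDegree_mem_support_of_nonzero h))
  exact Int.natAbs_pos.2 (leadingCoeff_ne_zero.2 h)

section ordering

variable {n : ℕ} {α : ℕ → ℝ}

lemma IsHeightOrdering.monotone (hα : IsHeightOrdering n α) : Monotone fun i => height (α i) :=
  monotone_nat_of_le_succ hα.height_le

lemma countFirst_eq_ncard_image (hα : IsHeightOrdering n α) (N : ℕ) (S : Set ℝ) :
    countFirst α N S = (α '' {i | i < N ∧ α i ∈ S}).ncard :=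
  (Set.ncard_image_of_injective _ hα.injective).symm

lemma finite_image_first (N : ℕ) (S : Set ℝ) : (α '' {i | i < N ∧ α i ∈ S}).Finite :=
  ((Set.finite_lt_nat N).subset fun _ hi => hi.1).image α

/-- Indexing starts at `0`, so `α (N - 1)` is the last of the first `N` terms and has the largest
height among them. -/
lemma countFirst_le (hα : IsHeightOrdering n α) {N : ℕ} (hN : 1 ≤ N) (S : Set ℝ) :
    countFirst α N S ≤ countingFunction n (height (α (N - 1))) S := by
  rw [countFirst_eq_ncard_image hα, countingFunction]
  refine Set.ncard_le_ncard ?_ ((finite_algNumbersLE n _).subset Set.inter_subset_left)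
  rintro _ ⟨i, ⟨hi, hiS⟩, rfl⟩
  refine ⟨⟨?_, ?_⟩, hiS⟩
  · rw [← hα.range_eq]
    exact Set.mem_range_self i
  · exact_mod_cast hα.monotone (by omega : i ≤ N - 1)

/-- A number of height strictly below that of the last term must already have been listed. Ties at
the last height are undetermined, hence the `- 1`. -/
lemma le_countFirst (hα : IsHeightOrdering n α) {N : ℕ} (S : Set ℝ) :
    countingFunction n ((height (α (N - 1)) : ℝ) - 1) S ≤ countFirst α N S := by
  rw [countFirst_eq_ncard_image hα, countingFunction]
  refine Set.ncard_le_ncard ?_ (finite_image_first N S)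
  rintro x ⟨⟨hx, hht⟩, hxS⟩
  rw [← hα.range_eq] at hx
  obtain ⟨i, rfl⟩ := hx
  refine ⟨i, ⟨?_, hxS⟩, rfl⟩
  by_contra hi
  have h1 : height (α (N - 1)) ≤ height (α i) := hα.monotone (by omega)
  have h2 : (height (α (N - 1)) : ℝ) ≤ height (α i) := by exact_mod_cast h1
  linarith

lemma countFirst_univ (N : ℕ) : countFirst α N Set.univ = N := by
  have : {i | i < N ∧ α i ∈ Set.univ} = (Finset.range N : Set ℕ) := by
    ext i
    simp
  rw [countFirst, this, Set.ncard_coe_finset, Finset.card_range]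

end ordering

lemma pow_succ_sub_pow_succ_le (n : ℕ) {Q : ℝ} (hQ : 1 ≤ Q) :
    Q ^ (n + 1) - (Q - 1) ^ (n + 1) ≤ (n + 1) * Q ^ n := by
  induction n with
  | zero => simp
  | succ n ih =>
    have h1 : (Q - 1) ^ (n + 1) ≤ Q ^ (n + 1) := by
      gcongr
      linarith
    have h2 : Q * (Q ^ (n + 1) - (Q - 1) ^ (n + 1)) ≤ Q * ((n + 1) * Q ^ n) := by gcongr
    calc Q ^ (n + 1 + 1) - (Q - 1) ^ (n + 1 + 1) =
        Q * (Q ^ (n + 1) - (Q - 1) ^ (n + 1)) + (Q - 1) ^ (n + 1) := by ring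
      _ ≤ Q * ((n + 1) * Q ^ n) + Q ^ (n + 1) := add_le_add h2 h1
      _ = _ := by push_cast; ring

lemma exists_abs_countFirst_sub_le {n : ℕ} (hn : 2 ≤ n) : ∃ C : ℝ, 0 ≤ C ∧
    ∀ α : ℕ → ℝ, IsHeightOrdering n α → ∀ I : Set ℝ, I.OrdConnected → ∀ N : ℕ, 1 ≤ N →
      |(countFirst α N I : ℝ) - primitiveDensity (n + 1) / 2 * rootVolume (n + 1) I *
        (height (α (N - 1)) : ℝ) ^ (n + 1)| ≤ C * errorTerm n (height (α (N - 1))) := by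
  obtain ⟨C, hC0, hC⟩ := exists_abs_countingFunction_sub_le hn
  have hK := primitiveDensity_pos (k := n + 1) (by omega)
  have hV := rootVolume_univ_pos (n := n) (by omega)
  set c := primitiveDensity (n + 1) / 2 * rootVolume (n + 1) Set.univ with hc
  have hc0 : 0 ≤ c := by positivity
  refine ⟨C + c * (n + 1), by positivity, fun α hα I hI N hN => ?_⟩
  set cI := primitiveDensity (n + 1) / 2 * rootVolume (n + 1) I with hcI
  have hcI0 : 0 ≤ cI := mul_nonneg (by positivity) (rootVolume_nonneg _ _)
  have hcIc : cI ≤ c := mul_le_mul_of_nonneg_left (rootVolume_le_univ n hI) (by positivity)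
  have halg : IsAlgebraic ℤ (α (N - 1)) := by
    have : α (N - 1) ∈ algNumbers n := by
      rw [← hα.range_eq]
      exact Set.mem_range_self _
    exact this.1
  have hle : (countFirst α N I : ℝ) ≤ countingFunction n (height (α (N - 1))) I := by
    exact_mod_cast countFirst_le hα hN I
  have hge : (countingFunction n ((height (α (N - 1)) : ℝ) - 1) I : ℝ) ≤ countFirst α N I := by
    exact_mod_cast le_countFirst hα (N := N) I
  have hQ : (1 : ℝ) ≤ (height (α (N - 1)) : ℝ) := by exact_mod_cast one_le_height halg
  -- The counting asymptotics require an argument at least `1`, so `Q - 1` is usable only for `Q ≥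
  -- 2`. For `Q = 1` the lower bound is trivial, the count being nonnegative.
  have hcases : (height (α (N - 1)) : ℝ) = 1 ∨ (2 : ℝ) ≤ (height (α (N - 1)) : ℝ) := by
    rcases (one_le_height halg).eq_or_lt with h | h
    · left
      exact_mod_cast h.symm
    · right
      exact_mod_cast h
  generalize (height (α (N - 1)) : ℝ) = Q at *
  have hE := errorTerm_nonneg n hQ
  have hQE := pow_le_errorTerm n hQ
  have hdiff : cI * (Q ^ (n + 1) - (Q - 1) ^ (n + 1)) ≤ c * (n + 1) * errorTerm n Q := by
    calc _ ≤ c * ((n + 1) * Q ^ n) := by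
          refine mul_le_mul hcIc (pow_succ_sub_pow_succ_le n hQ) ?_ hc0
          rw [sub_nonneg]
          gcongr
          linarith
      _ ≤ c * ((n + 1) * errorTerm n Q) := by gcongr
      _ = _ := by ring
  have hup := (abs_le.1 (hC I hI Q hQ)).2
  have hcE : 0 ≤ c * (n + 1) * errorTerm n Q := by positivity
  have hCE : 0 ≤ C * errorTerm n Q := by positivity
  change _ - cI * Q ^ (n + 1) ≤ C * errorTerm n Q at hup
  rw [abs_le, add_mul]
  constructor
  · rcases hcases with h | h
    · subst h
      have h0 : (0 : ℝ) ≤ countFirst α N I := Nat.cast_nonneg _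
      rw [sub_self, zero_pow (Nat.succ_ne_zero n)] at hdiff
      linarith
    · have hlow := (abs_le.1 (hC I hI (Q - 1) (by linarith))).1
      have hmono : C * errorTerm n (Q - 1) ≤ C * errorTerm n Q :=
        mul_le_mul_of_nonneg_left (errorTerm_mono n (by linarith) (by linarith)) hC0
      change -(C * errorTerm n (Q - 1)) ≤ _ - cI * (Q - 1) ^ (n + 1) at hlow
      linarith
  · linarith

/-- For large `Q` the error is less than half the main term, so `N ≥ c * Q ^ (n + 1) / 2`; bounded
`Q` are absorbed into `A`. -/
lemma exists_pow_le_mul_of_le {n : ℕ} {c C : ℝ} (hc : 0 < c) :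
    ∃ A : ℝ, 1 ≤ A ∧ ∀ N Q : ℝ, 1 ≤ N → 1 ≤ Q →
      c * Q ^ (n + 1) - C * errorTerm n Q ≤ N → Q ^ (n + 1) ≤ A * N := by
  have h := (tendsto_errorTerm_div n).const_mul C
  rw [mul_zero] at h
  obtain ⟨Q₀, hQ₀⟩ := eventually_atTop.1 (h.eventually_lt_const (half_pos hc))
  refine ⟨max (max 1 (2 / c)) (|Q₀| ^ (n + 1)), le_max_of_le_left (le_max_left _ _), ?_⟩
  intro N Q hN hQ hle
  have hQ0 : 0 < Q ^ (n + 1) := by positivity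
  rcases le_or_gt Q₀ Q with h1 | h1
  · have h2 := hQ₀ Q h1
    rw [← mul_div_assoc, div_lt_iff₀ hQ0] at h2
    have h3 : Q ^ (n + 1) ≤ 2 / c * N := by
      rw [div_mul_eq_mul_div, le_div_iff₀ hc]
      linarith
    refine h3.trans (mul_le_mul_of_nonneg_right ?_ (by linarith))
    exact le_max_of_le_left (le_max_right _ _)
  · have h2 : Q ^ (n + 1) ≤ |Q₀| ^ (n + 1) := by
      gcongr
      exact h1.le.trans (le_abs_self _)
    calc Q ^ (n + 1) ≤ |Q₀| ^ (n + 1) * 1 := by rwa [mul_one]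
      _ ≤ _ := mul_le_mul (le_max_right _ _) hN zero_le_one (by positivity)

/-- Raising the hypothesis to the power `n / (n + 1)` bounds `Q ^ n`. The additive constants in the
logarithm are absorbed using `log N ≥ log 2`, which is where `N ≥ 2` enters. -/
lemma errorTerm_le_of_pow_le {n : ℕ} {A N Q : ℝ} (hA : 1 ≤ A) (hN : 2 ≤ N) (hQ : 1 ≤ Q)
    (h : Q ^ (n + 1) ≤ A * N) : errorTerm n Q ≤ A * ((1 + Real.log A) / Real.log 2 + 1) ^ ell n *
      (N ^ ((n : ℝ) / ((n : ℝ) + 1)) * Real.log N ^ ell n) := by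
  have hQ0 : 0 < Q := by linarith
  have hlog2 : 0 < Real.log 2 := Real.log_pos (by norm_num)
  have hlogA := Real.log_nonneg hA
  have hlogQ := Real.log_nonneg hQ
  have hlogN : Real.log 2 ≤ Real.log N := Real.log_le_log (by norm_num) hN
  have he0 : (0 : ℝ) ≤ (n : ℝ) / ((n : ℝ) + 1) := by positivity
  have he1 : (n : ℝ) / ((n : ℝ) + 1) ≤ 1 := by
    rw [div_le_one (by positivity)]
    linarith
  have h1 : Q ^ n ≤ A * N ^ ((n : ℝ) / ((n : ℝ) + 1)) := by
    have h2 : Q ^ n = (Q ^ (n + 1)) ^ ((n : ℝ) / ((n : ℝ) + 1)) := by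
      rw [← Real.rpow_natCast Q (n + 1), ← Real.rpow_mul hQ0.le, ← Real.rpow_natCast Q n]
      congr 1
      push_cast
      field_simp
    rw [h2]
    calc _ ≤ (A * N) ^ ((n : ℝ) / ((n : ℝ) + 1)) := by gcongr
      _ = A ^ ((n : ℝ) / ((n : ℝ) + 1)) * N ^ ((n : ℝ) / ((n : ℝ) + 1)) :=
          Real.mul_rpow (by linarith) (by linarith)
      _ ≤ _ := by
          gcongr
          calc A ^ ((n : ℝ) / ((n : ℝ) + 1)) ≤ A ^ (1 : ℝ) :=
                Real.rpow_le_rpow_of_exponent_le hA he1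
            _ = A := Real.rpow_one A
  have h3 : 1 + Real.log Q ≤ ((1 + Real.log A) / Real.log 2 + 1) * Real.log N := by
    have h4 : Real.log Q ≤ Real.log A + Real.log N := by
      rw [← Real.log_mul (by linarith) (by linarith)]
      refine Real.log_le_log hQ0 (le_trans ?_ h)
      calc Q = Q ^ 1 := (pow_one Q).symm
        _ ≤ Q ^ (n + 1) := pow_le_pow_right₀ hQ (by omega)
    have h5 : 1 + Real.log A ≤ (1 + Real.log A) / Real.log 2 * Real.log N := by
      rw [div_mul_eq_mul_div, le_div_iff₀ hlog2]
      gcongr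
    linarith
  have hN0 : 0 ≤ N := by linarith
  have hlogN0 : 0 ≤ Real.log N := by linarith
  calc errorTerm n Q ≤ (A * N ^ ((n : ℝ) / ((n : ℝ) + 1))) *
        (((1 + Real.log A) / Real.log 2 + 1) * Real.log N) ^ ell n := by
        rw [errorTerm]
        gcongr
    _ = _ := by
        rw [mul_pow]
        ring

end RealAlgDist

/-! ### The main theorem -/

theorem mainTheorem3 (n : ℕ) (hn : 2 ≤ n) :
    (∀ x : ℝ, Tendsto (RealAlgDist.proportion n x) atTop
      (𝓝 (RealAlgDist.distributionFunction n x))) ∧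
    (∀ x : ℝ, HasDerivAt (RealAlgDist.distributionFunction n)
      (RealAlgDist.distributionDensity n x) x) ∧
    MeasureTheory.Integrable (RealAlgDist.distributionDensity n) ∧
    ∃ C : ℝ, ∀ α : ℕ → ℝ, RealAlgDist.IsHeightOrdering n α →
      ∀ I : Set ℝ, I.OrdConnected → ∀ N : ℕ, 2 ≤ N →
        |(RealAlgDist.countFirst α N I : ℝ) - N * ∫ x in I, RealAlgDist.distributionDensity n x| ≤
          C * ((N : ℝ) ^ ((n : ℝ) / ((n : ℝ) + 1)) * Real.log N ^ RealAlgDist.ell n) := by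
  open RealAlgDist in
  refine ⟨fun x => ?_, fun x => ?_, ?_, ?_⟩
  · rw [distributionFunction_eq hn]
    exact tendsto_proportion hn x
  · rw [distributionDensity_eq hn]
    exact hasDerivAt_distributionFunction hn x
  · rw [distributionDensity_eq hn]
    exact (integrable_rootDensity n).div_const _
  · obtain ⟨C, hC0, hC⟩ := exists_abs_countFirst_sub_le hn
    have hK := primitiveDensity_pos (k := n + 1) (by omega)
    have hV := rootVolume_univ_pos (n := n) (by omega)
    set c := primitiveDensity (n + 1) / 2 * rootVolume (n + 1) Set.univ with hc
    have hc0 : 0 < c := by positivity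
    obtain ⟨A, hA, hpow⟩ := exists_pow_le_mul_of_le (n := n) (C := C) hc0
    -- The factor `2 * C` collects the errors for `I` and for the whole line; the rest is the
    -- conversion from height to `N`.
    refine ⟨2 * C * (A * ((1 + Real.log A) / Real.log 2 + 1) ^ ell n), ?_⟩
    intro α hα I hI N hN
    have hN2 : (2 : ℝ) ≤ N := by exact_mod_cast hN
    have hI' := hC α hα I hI N (by omega)
    -- On the whole line the count is `N` itself, which ties `N` to `c * Q ^ (n + 1)`.
    have hu := hC α hα Set.univ Set.ordConnected_univ N (by omega)
    rw [countFirst_univ, ← hc] at hu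
    have halg : IsAlgebraic ℤ (α (N - 1)) := by
      have : α (N - 1) ∈ algNumbers n := by
        rw [← hα.range_eq]
        exact Set.mem_range_self _
      exact this.1
    have hQ : (1 : ℝ) ≤ (height (α (N - 1)) : ℝ) := by exact_mod_cast one_le_height halg
    generalize (height (α (N - 1)) : ℝ) = Q at *
    have hE := errorTerm_le_of_pow_le (n := n) hA hN2 hQ
      (hpow N Q (by linarith) hQ (by linarith [(abs_le.1 hu).1]))
    rw [setIntegral_distributionDensity hn hI]
    set r := rootVolume (n + 1) I / rootVolume (n + 1) Set.univ with hr
    have hr0 : 0 ≤ r := div_nonneg (rootVolume_nonneg _ _) hV.le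
    have hr1 : r ≤ 1 := (div_le_one hV).2 (rootVolume_le_univ n hI)
    have hcr : primitiveDensity (n + 1) / 2 * rootVolume (n + 1) I = c * r := by
      rw [hc, hr]
      field_simp
    rw [hcr] at hI'
    -- Subtracting `r` times the whole-line estimate cancels the main term `c * r * Q ^ (n + 1)`,
    -- and `r ≤ 1` keeps the constant independent of `I`.
    have hsplit : (countFirst α N I : ℝ) - N * r =
        (countFirst α N I - c * r * Q ^ (n + 1)) - r * (N - c * Q ^ (n + 1)) := by ring
    calc |(countFirst α N I : ℝ) - N * r| ≤ |countFirst α N I - c * r * Q ^ (n + 1)| +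
          |r * (N - c * Q ^ (n + 1))| := by
          rw [hsplit]
          exact abs_sub _ _
      _ ≤ C * errorTerm n Q + 1 * (C * errorTerm n Q) := by
          rw [abs_mul, abs_of_nonneg hr0]
          exact add_le_add hI' (mul_le_mul hr1 hu (abs_nonneg _) zero_le_one)
      _ = 2 * C * errorTerm n Q := by ring
      _ ≤ 2 * C * _ := mul_le_mul_of_nonneg_left hE (by positivity)
      _ = _ := by ring
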